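/- Fix finite sets $\mathcal V$ (Boolean state variables), $Ch$ (channels), $D$ (Boolean data variables), $K$ (agent identities) and $CV$ (Boolean common variables). An observation is a tuple $m=\langle ch,\mathbf d,k,\pi\rangle$ with $ch\in Ch$, $\mathbf d\in 2^{D}$, $k\in K$ and $\pi\subseteq 2^{CV}$; a system computation is a map $\rho$ from $\mathbb N$ to pairs of a state in $2^{\mathcal V}$ and an observation. Observation descriptors and LTOL formulas are $$O ::= cv\mid\neg cv\mid ch\mid\neg ch\mid k\mid\neg k\mid d\mid\neg d\mid \bullet^{\exists}O\mid\bullet^{\forall}O\mid O\vee O\mid O\wedge O,$$ $$\varphi ::= v\mid\neg v\mid\varphi\vee\varphi\mid\varphi\wedge\varphi\mid\varphi\,\mathcal U\varphi\mid\varphi\,\mathcal R\varphi\mid\langle O\rangle\varphi\mid[O]\varphi .$$ Here $m\models cv$ iff every $c\in\pi$ satisfies $cv$, and $m\models\neg cv$ iff some $c\in\pi$ does not; $m\models\bullet^{\exists}O$ (resp. $\bullet^{\forall}O$) iff $\langle ch,\mathbf d,k,\{c\}\rangle\models O$ for some (resp. every) $c\in\pi$; the other descriptors have the obvious meaning. State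 literals, Boolean connectives, until and release are interpreted over the suffixes $\rho_{\ge i}$ as in LTL; $\rho_{\ge i}\models\langle O\rangle\varphi$ iff $m_i\models O$ and $\rho_{\ge i+1}\models\varphi$; $\rho_{\ge i}\models[O]\varphi$ iff $m_i\models O$ implies $\rho_{\ge i+1}\models\varphi$. Let $|\varphi|$ be the number of symbols of $\varphi$ (descriptors included, each literal being one symbol), let $\mathrm{obs}(\varphi)$ be the set of descriptors $O$ that occur in $\varphi$ as the argument of an operator $\langle O\rangle$ or $[O]$, and let $\Sigma=2^{\mathcal V}$, $\mathcal O=2^{\mathrm{obs}(\varphi)}$. For a word $w=(\sigma_0,o_0)(\sigma_1,o_1)\cdots\in(\Sigma\times\mathcal O)^\omega$ let $L(w)$ be the set of the computations $\rho$ whose state at every time $i$ is $\sigma_i$ and whose observation $m_i$ satisfies exactly those $O\in\mathrm{obs}(\varphi)$ that belong to $o_i$. There is a constant $C$, independent of the fixed sets, such that for every LTOL formula $\varphi$ there is a nondeterministic Büchi word automaton $N_\varphi=\langle Q,\Sigma,\mathcal O,S^0,\delta,F\rangle$ over the alphabet $\Sigma\times\mathcal O$ for which $\bigcup_{w\in L(N_\varphi)}L(w)$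 is exactly the set of the computations that satisfy $\varphi$ (at time $0$), and: - $|Q|\le 2^{C|\varphi|}$; the number $|\delta|$ of transitions satisfies $|\delta|\le|Q|^2\cdot|\Sigma|\cdot|\mathcal O|$ and $|\delta|\le 2^{|\mathcal V|}\cdot2^{C|\varphi|}$ (hence $|\delta|$ is in $2^{O(|\varphi|)}$ when $\mathcal V$ is fixed, and uniformly so when $|\mathcal V|\le|\varphi|$); - $N_\varphi$ can be built in space $O(|\varphi|)$: for the fixed sets there is one deterministic Turing machine with a write-only output that, for every $\varphi$, started on $\varphi$ written in prefix notation with one symbol per cell, halts with a complete list of the states (with names, and marks for initial and accepting ones) and of the transitions of $N_\varphi$ as its output, and visits at most $C|\varphi|$ tape cells, those of the input included and the output not counted; - the size $|Q|\cdot|\delta|$ of $N_\varphi$ is at most $2^{|\mathcal V|}\cdot2^{C|\varphi|}$ (hence in $2^{O(|\varphi|)}$ in the same sense). -/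

import Mathlib

namespace LTOL

/-! ## Observations and observation descriptors

`V`, `Ch`, `D`, `K`, `CV` are the sets of (Boolean) state variables, channels, (Boolean) data
variables, agent identities and (Boolean) common variables. -/

/-- An observation `⟨ch, d, k, π⟩`: a channel, an assignment to the data variables, a sender, and a
predicate over the common variables, given as a set of assignments. -/
structure Observation (Ch D K CV : Type) where
  ch : Ch
  data : D → Bool
  sender : K
  pred : Set (CV → Bool)

/-- Observation descriptors, in positive normal form. -/
inductive Descriptor (Ch D K CV : Type) : Type
  | cv (x : CV)
  | ncv (x : CV)
  | ch (a : Ch)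
  | nch (a : Ch)
  | agent (k : K)
  | nagent (k : K)
  | data (d : D)
  | ndata (d : D)
  | ex (O : Descriptor Ch D K CV)
  | all (O : Descriptor Ch D K CV)
  | or (O₁ O₂ : Descriptor Ch D K CV)
  | and (O₁ O₂ : Descriptor Ch D K CV)

/-- `O.Sat m` is `m ⊨ O`. -/
def Descriptor.Sat {Ch D K CV : Type} : Descriptor Ch D K CV → Observation Ch D K CV → Prop
  | .cv x, m => ∀ c ∈ m.pred, c x = true
  | .ncv x, m => ∃ c ∈ m.pred, ¬ c x = true
  | .ch a, m => m.ch = a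
  | .nch a, m => m.ch ≠ a
  | .agent k, m => m.sender = k
  | .nagent k, m => m.sender ≠ k
  | .data d, m => m.data d = true
  | .ndata d, m => ¬ m.data d = true
  | .ex O, m => ∃ c ∈ m.pred, O.Sat { m with pred := {c} }
  | .all O, m => ∀ c ∈ m.pred, O.Sat { m with pred := {c} }
  | .or O₁ O₂, m => O₁.Sat m ∨ O₂.Sat m
  | .and O₁ O₂, m => O₁.Sat m ∧ O₂.Sat m

/-! ## Formulas -/

/-- LTOL formulas, in positive normal form. -/
inductive Formula (V Ch D K CV : Type) : Type
  | var (v : V)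
  | nvar (v : V)
  | or (φ ψ : Formula V Ch D K CV)
  | and (φ ψ : Formula V Ch D K CV)
  | until (φ ψ : Formula V Ch D K CV)
  | release (φ ψ : Formula V Ch D K CV)
  /-- possible: `⟨O⟩ φ` -/
  | possible (O : Descriptor Ch D K CV) (φ : Formula V Ch D K CV)
  /-- necessary: `[O] φ` -/
  | necessary (O : Descriptor Ch D K CV) (φ : Formula V Ch D K CV)

/-- A system computation: at every time point a system state (an assignment to the state variables)
and an observation. -/
abbrev Computation (V Ch D K CV : Type) : Type :=
  ℕ → (V → Bool) × Observation Ch D K CV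

/-- `φ.SatAt ρ i` is `ρ_{≥ i} ⊨ φ`. -/
def Formula.SatAt {V Ch D K CV : Type} :
    Formula V Ch D K CV → Computation V Ch D K CV → ℕ → Prop
  | .var v, ρ, i => (ρ i).1 v = true
  | .nvar v, ρ, i => ¬ (ρ i).1 v = true
  | .or φ ψ, ρ, i => φ.SatAt ρ i ∨ ψ.SatAt ρ i
  | .and φ ψ, ρ, i => φ.SatAt ρ i ∧ ψ.SatAt ρ i
  | .until φ ψ, ρ, i => ∃ j, i ≤ j ∧ ψ.SatAt ρ j ∧ ∀ k, i ≤ k → k < j → φ.SatAt ρ k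
  | .release φ ψ, ρ, i => ∀ j, i ≤ j → ψ.SatAt ρ j ∨ ∃ k, i ≤ k ∧ k < j ∧ φ.SatAt ρ k
  | .possible O φ, ρ, i => O.Sat (ρ i).2 ∧ φ.SatAt ρ (i + 1)
  | .necessary O φ, ρ, i => O.Sat (ρ i).2 → φ.SatAt ρ (i + 1)

/-! ## Formulas as words, size -/

/-- The symbols from which formulas and descriptors are written. -/
inductive Token (V Ch D K CV : Type) : Type
  | cv (x : CV)
  | ncv (x : CV)
  | ch (a : Ch)
  | nch (a : Ch)
  | agent (k : K)
  | nagent (k : K)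
  | data (d : D)
  | ndata (d : D)
  | ex
  | all
  | descOr
  | descAnd
  | var (v : V)
  | nvar (v : V)
  | or
  | and
  | until
  | release
  | possible
  | necessary
  deriving Fintype

/-- A descriptor in prefix (Polish) notation. -/
def Descriptor.word {V Ch D K CV : Type} : Descriptor Ch D K CV → List (Token V Ch D K CV)
  | .cv x => [.cv x]
  | .ncv x => [.ncv x]
  | .ch a => [.ch a]
  | .nch a => [.nch a]
  | .agent k => [.agent k]
  | .nagent k => [.nagent k]
  | .data d => [.data d]
  | .ndata d => [.ndata d]
  | .ex O => .ex :: O.word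
  | .all O => .all :: O.word
  | .or O₁ O₂ => .descOr :: (O₁.word ++ O₂.word)
  | .and O₁ O₂ => .descAnd :: (O₁.word ++ O₂.word)

/-- A formula in prefix (Polish) notation. -/
def Formula.word {V Ch D K CV : Type} : Formula V Ch D K CV → List (Token V Ch D K CV)
  | .var v => [.var v]
  | .nvar v => [.nvar v]
  | .or φ ψ => .or :: (φ.word ++ ψ.word)
  | .and φ ψ => .and :: (φ.word ++ ψ.word)
  | .until φ ψ => .until :: (φ.word ++ ψ.word)
  | .release φ ψ => .release :: (φ.word ++ ψ.word)
  | .possible O φ => .possible :: (O.word ++ φ.word)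
  | .necessary O φ => .necessary :: (O.word ++ φ.word)

/-- The size `|φ|`: the number of symbols of `φ`, those of its descriptors included. -/
def Formula.size {V Ch D K CV : Type} (φ : Formula V Ch D K CV) : ℕ := φ.word.length

/-! ## The observation alphabet and words -/

/-- The top-level descriptors of `φ` (the arguments of its operators `⟨·⟩` and `[·]`), listed by
occurrence from left to right. -/
def Formula.descriptors {V Ch D K CV : Type} :
    Formula V Ch D K CV → List (Descriptor Ch D K CV)
  | .var _ => []
  | .nvar _ => []
  | .or φ ψ => φ.descriptors ++ ψ.descriptors
  | .and φ ψ => φ.descriptors ++ ψ.descriptors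
  | .until φ ψ => φ.descriptors ++ ψ.descriptors
  | .release φ ψ => φ.descriptors ++ ψ.descriptors
  | .possible O φ => O :: φ.descriptors
  | .necessary O φ => O :: φ.descriptors

/-- The set `obs(φ)` of the top-level descriptors of `φ`, as a type. -/
abbrev Formula.Obs {V Ch D K CV : Type} (φ : Formula V Ch D K CV) : Type :=
  {O : Descriptor Ch D K CV // O ∈ φ.descriptors}

/-- Letters: pairs from the state alphabet `2^V` and the observation alphabet `2^obs(φ)`. -/
abbrev Formula.Letter {V Ch D K CV : Type} (φ : Formula V Ch D K CV) : Type :=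
  (V → Bool) × Set φ.Obs

/-- `L(w)`: the set of the computations satisfying the word `w`. -/
def Formula.wordLang {V Ch D K CV : Type} (φ : Formula V Ch D K CV) (w : ℕ → φ.Letter) :
    Set (Computation V Ch D K CV) :=
  {ρ | ∀ i, (ρ i).1 = (w i).1 ∧ ∀ O : φ.Obs, O.1.Sat (ρ i).2 ↔ O ∈ (w i).2}

/-! ## Nondeterministic Büchi word automata -/

/-- A nondeterministic Büchi word automaton over the alphabet `A`. -/
structure NBW (A : Type) where
  Q : Type
  finite_Q : Finite Q
  init : Set Q
  δ : Q → A → Set Q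
  F : Set Q

/-- `r` is an accepting run on `w`: some state of `F` appears in it infinitely often. -/
def NBW.IsAcceptingRun {A : Type} (N : NBW A) (w : ℕ → A) (r : ℕ → N.Q) : Prop :=
  r 0 ∈ N.init ∧ (∀ i, r (i + 1) ∈ N.δ (r i) (w i)) ∧
    ∃ q ∈ N.F, ∃ᶠ i in Filter.atTop, r i = q

/-- The language of an automaton. -/
def NBW.lang {A : Type} (N : NBW A) : Set (ℕ → A) :=
  {w | ∃ r, N.IsAcceptingRun w r}

/-- The transitions of an automaton, as a set of triples. -/
def NBW.transitions {A : Type} (N : NBW A) : Set (N.Q × A × N.Q) :=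
  {t | t.2.2 ∈ N.δ t.1 t.2.1}

/-- `|Q|`. -/
noncomputable def NBW.numStates {A : Type} (N : NBW A) : ℕ := Nat.card N.Q

/-- `|δ|`: the number of transitions. -/
noncomputable def NBW.numTransitions {A : Type} (N : NBW A) : ℕ := Nat.card N.transitions

/-- The size `|Q| · |δ|` of an automaton. -/
noncomputable def NBW.size {A : Type} (N : NBW A) : ℕ := N.numStates * N.numTransitions

/-! ## Written descriptions of automata -/

/-- The symbols from which descriptions of automata are written. -/
inductive OutSym (V : Type) : Type
  | state
  | trans
  | bit (b : Bool)
  | letter (σ : V → Bool)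
  | arrow

open Classical in
/-- The record of a state: two bits telling whether it is initial and whether it is accepting, and
then its name. -/
noncomputable def stateRecord {V Ch D K CV : Type} {φ : Formula V Ch D K CV} (N : NBW φ.Letter)
    (name : N.Q → List Bool) (q : N.Q) : List (OutSym V) :=
  .state :: .bit (decide (q ∈ N.init)) :: .bit (decide (q ∈ N.F)) :: (name q).map .bit

open Classical in
/-- The record of a transition `(q, (σ, o), q')`: the name of `q`, then `σ`, then `o`, written as
the list of the bits `O ∈ o` where `O` runs through the occurrences of top-level descriptors in `φ`,
then the name of `q'`. -/
noncomputable def transRecord {V Ch D K CV : Type} {φ : Formula V Ch D K CV} (N : NBW φ.Letter)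
    (name : N.Q → List Bool) (t : N.Q × φ.Letter × N.Q) : List (OutSym V) :=
  .trans :: ((name t.1).map .bit ++ .letter t.2.1.1 ::
    (φ.descriptors.attach.map (fun O => .bit (decide (O ∈ t.2.1.2))) ++
      .arrow :: (name t.2.2).map .bit))

/-- `out` is a description of `N`: for some naming of the states by distinct bit strings, it is a
list of the records of all states, each once, followed by the records of all transitions, each
once. -/
def IsDescription {V Ch D K CV : Type} {φ : Formula V Ch D K CV} (N : NBW φ.Letter)
    (out : List (OutSym V)) : Prop :=
  ∃ (name : N.Q → List Bool) (qs : List N.Q) (ts : List (N.Q × φ.Letter × N.Q)),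
    Function.Injective name ∧
    qs.Nodup ∧ (∀ q, q ∈ qs) ∧
    ts.Nodup ∧ (∀ t, t ∈ ts ↔ t ∈ N.transitions) ∧
    out = qs.flatMap (stateRecord N name) ++ ts.flatMap (transRecord N name)

/-! ## Turing machines with a write-only output -/

/-- The movements of a head. -/
inductive Move : Type
  | left
  | stay
  | right

/-- The cell reached by a movement on a tape that is infinite to the right only; a movement to the
left has no effect in the leftmost cell. -/
def Move.apply : Move → ℕ → ℕ
  | .left, n => n - 1
  | .stay, n => n
  | .right, n => n + 1

/-- A deterministic Turing machine with tapes `0, …, k`, finitely many states and a finite tape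
alphabet: a cell is blank or holds an input symbol from `I` or a symbol from `Γ`. In a step, which
depends on the state and on the scanned symbols only, it writes into the scanned cells, moves the
heads, and appends some symbols from `X` to the output, which it never reads; or it halts. -/
structure Machine (I X : Type) [Finite I] where
  k : ℕ
  Γ : Type
  finite_Γ : Finite Γ
  S : Type
  finite_S : Finite S
  start : S
  step : S → (Fin (k + 1) → Option (I ⊕ Γ)) →
    Option (S × (Fin (k + 1) → Option (I ⊕ Γ) × Move) × List X)

/-- A configuration of a machine. -/
structure Machine.Config {I X : Type} [Finite I] (M : Machine I X) where
  state : M.S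
  tape : Fin (M.k + 1) → ℕ → Option (I ⊕ M.Γ)
  head : Fin (M.k + 1) → ℕ
  out : List X

/-- The initial configuration: the input is at the left end of tape `0`, all other cells are blank,
and every head is in the leftmost cell. -/
def Machine.initial {I X : Type} [Finite I] (M : Machine I X) (w : List I) : M.Config where
  state := M.start
  tape := fun i n => if i = 0 then w[n]?.map Sum.inl else none
  head := fun _ => 0
  out := []

/-- The next configuration, if the machine does not halt. -/
def Machine.next {I X : Type} [Finite I] (M : Machine I X) (c : M.Config) : Option M.Config :=
  (M.step c.state (fun i => c.tape i (c.head i))).map fun a =>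
    { state := a.1
      tape := fun i => Function.update (c.tape i) (c.head i) (a.2.1 i).1
      head := fun i => (a.2.1 i).2.apply (c.head i)
      out := c.out ++ a.2.2 }

/-- On input `w`, the machine halts with output `out`. -/
def Machine.HaltsWith {I X : Type} [Finite I] (M : Machine I X) (w : List I) (out : List X) :
    Prop :=
  ∃ c, StateTransition.Reaches M.next (M.initial w) c ∧ M.next c = none ∧ c.out = out

/-- On input `w`, the machine uses at most `s` tape cells: the numbers of cells that are visited on
its tapes (that of the input included, the output excluded) sum up to at most `s`. -/
def Machine.UsesSpace {I X : Type} [Finite I] (M : Machine I X) (w : List I) (s : ℕ) : Prop :=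
  ∃ b : Fin (M.k + 1) → ℕ, ∑ i, b i ≤ s ∧
    ∀ c, StateTransition.Reaches M.next (M.initial w) c → ∀ i, c.head i < b i

end LTOL

/-! The automaton is laid out over the written formula: a state attaches two bits to every symbol of
`φ`, so there are `4 ^ |φ|` states. The first bit of a position is an obligation to make the
subformula written there true; the one-step unfoldings of until and release turn this into
conditions on two consecutive states (`Formula.Step`). Obligations only have to imply truth, which
suffices because formulas are in positive normal form. The second bit is a breakpoint construction:
it records that an until has been without pending obligation at some time since the last accepting
state, and a state is accepting when all these bits are set. Visiting accepting states infinitely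
often therefore rules out an until that is postponed forever (`frequently_of_breakpoints`,
`Formula.satAt_of_step`). Conversely, the labelling by true subformulas is an accepting run
(`Formula.step_of_label`, `frequently_sinceBreak`). Together these give
`Formula.iUnion_wordLang_automaton`. At most `2 ^ |φ|` sets of descriptors occur as letters, and the
bounds on transitions and size are products.

For the space bound, a pair of states is a word with one digit from a fixed finite set per input
cell, so all pairs can be counted through in place. Whether a pair is a transition is decided by
evaluating `φ` bottom-up. The value of a subterm (`Val`) holds a few truth values, the local
conditions as a predicate of the letter, and the semantics of descriptors as explicit sets of
observations. For fixed finite sets of variables and names there are finitely many values,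
independently of `φ`, so a value fits into one cell. A word in prefix notation is evaluated from
right to left with a stack of at most `|φ| + 1` values, which is linear space. `Sweeper` abstracts
this kind of program, `Sweeper.Rounds.machine_spec` executes it on a two-tape machine, and
`Formula.exists_evaluates` shows that the values computed are those that the automaton needs.

The observation part of a letter is enumerated through observations kept in the finite control.
Several observations can realize the same set of descriptors; only a chosen representative
(`Canonical`) may print, so that each transition is listed once. -/

namespace LTOL

/-! ## Guarded runs of machines -/

section Runs
variable {I X : Type} [Finite I] {M : Machine I X} {P : M.Config → Prop}

/-- `c` is reached from `a` through configurations that satisfy `P`, both ends included. -/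
inductive Machine.Run (M : Machine I X) (P : M.Config → Prop) : M.Config → M.Config → Prop
  | refl {a : M.Config} : P a → Machine.Run M P a a
  | head {a b c : M.Config} : P a → M.next a = some b → Machine.Run M P b c → Machine.Run M P a c

theorem Machine.Config.eq_of {c d : M.Config} (hs : c.state = d.state) (ht : c.tape = d.tape)
    (hh : c.head = d.head) (ho : c.out = d.out) : c = d := by
  cases c
  cases d
  simp_all

theorem Machine.Run.trans {a b c : M.Config} (h : M.Run P a b) (h' : M.Run P b c) :
    M.Run P a c := by
  induction h with
  | refl _ => exact h'
  | head ha hab _ ih => exact .head ha hab (ih h')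

theorem Machine.Run.tail {a b c : M.Config} (h : M.Run P a b) (hbc : M.next b = some c)
    (hc : P c) : M.Run P a c := by
  induction h with
  | refl hb => exact .head hb hbc (.refl hc)
  | head ha hab _ ih => exact .head ha hab (ih hbc)

theorem Machine.Run.reaches {a c : M.Config} (h : M.Run P a c) :
    StateTransition.Reaches M.next a c := by
  induction h with
  | refl _ => exact Relation.ReflTransGen.refl
  | head _ hab _ ih => exact Relation.ReflTransGen.head hab ih

/-- A machine is deterministic, so all configurations reachable from `a` lie on the one run that
ends in the halting configuration. A guard checked along that run thus bounds the space of the whole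
computation. -/
theorem Machine.Run.forall_reaches {a c : M.Config} (h : M.Run P a c) (hc : M.next c = none)
    {d : M.Config} (hd : StateTransition.Reaches M.next a d) : P d := by
  induction h with
  | refl ha =>
    rcases Relation.ReflTransGen.cases_head hd with rfl | ⟨b, hb, _⟩
    · exact ha
    · simp [hc] at hb
  | head ha hab _ ih =>
    rcases Relation.ReflTransGen.cases_head hd with rfl | ⟨b, hb, hbd⟩
    · exact ha
    · rw [hab] at hb
      cases hb
      exact ih hc hbd

end Runs

/-! ## Tapes given by lists -/

section Tapes
variable {α : Type}

/-- A tape is given by a list with blanks beyond its end. Overwriting a cell, pushing at the end and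
popping from the end are the only changes a sweeper's machine makes. -/
theorem update_getElem?_append (a b : List α) (x y : α) :
    Function.update (fun n => (a ++ x :: b)[n]?) a.length (some y) =
      fun n => (a ++ y :: b)[n]? := by
  funext n
  rcases lt_trichotomy n a.length with h | rfl | h
  · simp [Function.update_of_ne h.ne, List.getElem?_append_left h]
  · simp
  · obtain ⟨k, rfl⟩ := Nat.exists_eq_add_of_lt h
    rw [Function.update_of_ne (by omega)]
    rw [List.getElem?_append_right (by omega), List.getElem?_append_right (by omega)]
    simp [show a.length + k + 1 - a.length = k + 1 by omega]

theorem update_getElem?_length (a : List α) (y : α) :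
    Function.update (fun n => a[n]?) a.length (some y) = fun n => (a ++ [y])[n]? := by
  funext n
  rcases lt_trichotomy n a.length with h | rfl | h
  · simp [Function.update_of_ne h.ne, List.getElem?_append_left h]
  · simp
  · rw [Function.update_of_ne (by omega)]
    rw [List.getElem?_eq_none (by omega), List.getElem?_eq_none (by simp; omega)]

theorem update_getElem?_none (a : List α) (x : α) :
    Function.update (fun n => (a ++ [x])[n]?) a.length none = fun n => a[n]? := by
  funext n
  rcases lt_trichotomy n a.length with h | rfl | h
  · simp [Function.update_of_ne h.ne, List.getElem?_append_left h]
  · simp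
  · rw [Function.update_of_ne (by omega)]
    rw [List.getElem?_eq_none (by simp; omega), List.getElem?_eq_none (by omega)]

end Tapes

/-! ## Sweepers -/

/-- A program that works in rounds on a word in prefix notation, each symbol of which carries a
digit from `E`. In a round it first evaluates the word as a term, from right to left, and so attaches
a value from `R` to each position; then a transducer goes through the word from left to right,
replaces the digits and produces output. -/
structure Sweeper (I X : Type) where
  E : Type
  R : Type
  C : Type
  L : Type
  finite_E : Finite E
  finite_R : Finite R
  finite_C : Finite C
  finite_L : Finite L
  zero : E
  bot : R
  start : C
  arity : I → Fin 3
  comb : I → E → R → R → R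
  begin : C → R → L × List X
  move : L → I → E → R → L × E × List X
  finish : L → Option C

namespace Sweeper
variable {I X : Type}

/-- The evaluation of a word from right to left: the word with the values attached, and the stack
of the values that are not used up, above a bottom element. -/
inductive Eval (P : Sweeper I X) : List (I × P.E) → List (I × P.E × P.R) → List P.R → Prop
  | nil : Eval P [] [] [P.bot]
  | leaf {u y s} (i : I) (e : P.E) : P.arity i = 0 → Eval P u y s →
      Eval P ((i, e) :: u) ((i, e, P.comb i e P.bot P.bot) :: y) (P.comb i e P.bot P.bot :: s)
  | unary {u y r s} (i : I) (e : P.E) : P.arity i = 1 → Eval P u y (r :: s) →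
      Eval P ((i, e) :: u) ((i, e, P.comb i e r P.bot) :: y) (P.comb i e r P.bot :: s)
  | binary {u y r r' s} (i : I) (e : P.E) : P.arity i = 2 → Eval P u y (r :: r' :: s) →
      Eval P ((i, e) :: u) ((i, e, P.comb i e r r') :: y) (P.comb i e r r' :: s)

/-- The transducer pass: the last state, the new word, and the output. -/
def pass (P : Sweeper I X) : P.L → List (I × P.E × P.R) → P.L × List (I × P.E) × List X
  | l, [] => (l, [], [])
  | l, (i, e, r) :: y =>
    ((P.pass (P.move l i e r).1 y).1,
      (i, (P.move l i e r).2.1) :: (P.pass (P.move l i e r).1 y).2.1,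
      (P.move l i e r).2.2 ++ (P.pass (P.move l i e r).1 y).2.2)

/-- From control state `c` on the word `u`, finitely many rounds lead to the end, with the given
output. -/
inductive Rounds (P : Sweeper I X) : P.C → List (I × P.E) → List X → Prop
  | last {c u y r} : P.Eval u y [r, P.bot] →
      P.finish (P.pass (P.begin c r).1 y).1 = none →
      Rounds P c u ((P.begin c r).2 ++ (P.pass (P.begin c r).1 y).2.2)
  | more {c u y r c' out} : P.Eval u y [r, P.bot] →
      P.finish (P.pass (P.begin c r).1 y).1 = some c' →
      Rounds P c' (P.pass (P.begin c r).1 y).2.1 out →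
      Rounds P c u ((P.begin c r).2 ++ (P.pass (P.begin c r).1 y).2.2 ++ out)

theorem Eval.length_eq {P : Sweeper I X} {u y s} (h : P.Eval u y s) : y.length = u.length := by
  induction h <;> simp_all

/-- A symbol removes its arguments and adds one value, so the stack grows by at most one per symbol.
This bounds the second tape. -/
theorem Eval.length_stack_le {P : Sweeper I X} {u y s} (h : P.Eval u y s) :
    s.length ≤ u.length + 1 := by
  induction h <;> simp_all <;> omega

theorem length_pass (P : Sweeper I X) (l : P.L) (y : List (I × P.E × P.R)) :
    (P.pass l y).2.1.length = y.length := by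
  induction y generalizing l with
  | nil => rfl
  | cons a y ih => obtain ⟨i, e, r⟩ := a; simp [pass, ih]

/-! ### Execution of a sweeper by a two-tape machine -/

/-- The states of the machine that executes a sweeper. -/
inductive State (P : Sweeper I X) : Type
  | load
  | up (c : P.C) (r : P.R)
  | pop (c : P.C) (r : P.R)
  | turn (c : P.C) (r : P.R)
  | down (l : P.L)

instance (P : Sweeper I X) : Finite P.State := by
  have := P.finite_C
  have := P.finite_R
  have := P.finite_L
  let f : P.State → Option (Fin 3 × P.C × P.R ⊕ P.L)
    | .load => none
    | .up c r => some (.inl (0, c, r))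
    | .pop c r => some (.inl (1, c, r))
    | .turn c r => some (.inl (2, c, r))
    | .down l => some (.inr l)
  refine Finite.of_injective f ?_
  rintro (_ | _ | _ | _ | _) (_ | _ | _ | _ | _) h <;> simp_all [f]

/-- The symbols that the machine writes: cells of the word, possibly with a value attached, and
values on the stack. -/
abbrev Cell (P : Sweeper I X) : Type := (I × P.E × Option P.R) ⊕ P.R

/-- A cell of the word. -/
abbrev cell (P : Sweeper I X) (i : I) (e : P.E) (r : Option P.R) : I ⊕ P.Cell :=
  .inr (.inl (i, e, r))

/-- A cell of the stack. -/
abbrev stk (P : Sweeper I X) (r : P.R) : I ⊕ P.Cell := .inr (.inr r)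

/-- The step function of the machine that executes a sweeper. -/
def step (P : Sweeper I X) : P.State → Option (I ⊕ P.Cell) → Option (I ⊕ P.Cell) →
    Option (P.State × (Option (I ⊕ P.Cell) × Move) × (Option (I ⊕ P.Cell) × Move) × List X)
  | .load, some (.inl i), b => some (.load, (some (P.cell i P.zero none), .right), (b, .stay), [])
  | .load, a, b => some (.up P.start P.bot, (a, .left), (b, .stay), [])
  | .up c r, some (.inr (.inl (i, e, none))), b =>
    if P.arity i = 0 then
      some (.up c (P.comb i e P.bot P.bot), (some (P.cell i e (P.comb i e P.bot P.bot)), .left),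
        (some (P.stk r), .right), [])
    else if P.arity i = 1 then
      some (.up c (P.comb i e r P.bot), (some (P.cell i e (P.comb i e r P.bot)), .left),
        (b, .stay), [])
    else some (.pop c r, (some (P.cell i e none), .stay), (b, .left), [])
  | .up c r, a, b => some (.turn c r, (a, .stay), (b, .left), [])
  | .pop c r, some (.inr (.inl (i, e, none))), some (.inr (.inr r')) =>
    some (.up c (P.comb i e r r'), (some (P.cell i e (P.comb i e r r')), .left), (none, .stay), [])
  | .pop _ _, _, _ => none
  | .turn c r, a, _ => some (.down (P.begin c r).1, (a, .stay), (none, .stay), (P.begin c r).2)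
  | .down l, some (.inr (.inl (i, e, some r))), b =>
    some (.down (P.move l i e r).1, (some (P.cell i (P.move l i e r).2.1 none), .right), (b, .stay),
      (P.move l i e r).2.2)
  | .down l, a, b => (P.finish l).map fun c => (.up c P.bot, (a, .left), (b, .stay), [])

variable [Finite I]

/-- The machine that executes a sweeper: tape `0` holds the word, tape `1` the stack. -/
def machine (P : Sweeper I X) : Machine I X where
  k := 1
  Γ := P.Cell
  finite_Γ := by
    have := P.finite_E
    have := P.finite_R
    infer_instance
  S := P.State
  finite_S := inferInstance
  start := .load
  step := fun s x => (P.step s (x 0) (x 1)).map fun a => (a.1, ![a.2.1, a.2.2.1], a.2.2.2)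

/-- The configuration with given state, tapes, heads and output. -/
def conf (P : Sweeper I X) (s : P.State) (a : List (I ⊕ P.Cell)) (h : ℕ) (b : List (I ⊕ P.Cell))
    (h' : ℕ) (out : List X) : P.machine.Config where
  state := s
  tape := ![fun n => a[n]?, fun n => b[n]?]
  head := ![h, h']
  out := out

theorem initial_eq_conf (P : Sweeper I X) (w : List I) :
    P.machine.initial w = P.conf .load (w.map .inl) 0 [] 0 [] := by
  refine Machine.Config.eq_of rfl ?_ ?_ rfl
  · funext i n
    refine Fin.cases (n := 1) ?_ (fun j => ?_) i
    · exact List.getElem?_map.symm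
    · obtain rfl : j = 0 := Subsingleton.elim _ _
      rfl
  · funext i
    refine Fin.cases (n := 1) rfl (fun j => ?_) i
    obtain rfl : j = 0 := Subsingleton.elim _ _
    rfl

theorem next_conf {P : Sweeper I X} {s s' : P.State} {a a' b b' : List (I ⊕ P.Cell)} {h h' : ℕ}
    {x y : Option (I ⊕ P.Cell)} {m m' : Move} {out o : List X}
    (hs : P.step s a[h]? b[h']? = some (s', (x, m), (y, m'), o))
    (ha : Function.update (fun n => a[n]?) h x = fun n => a'[n]?)
    (hb : Function.update (fun n => b[n]?) h' y = fun n => b'[n]?) :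
    P.machine.next (P.conf s a h b h' out) =
      some (P.conf s' a' (m.apply h) b' (m'.apply h') (out ++ o)) := by
  have : P.machine.step s (fun i => (P.conf s a h b h' out).tape i
      ((P.conf s a h b h' out).head i)) = some (s', ![(x, m), (y, m')], o) := by
    change (P.step s a[h]? b[h']?).map _ = _
    rw [hs]
    rfl
  unfold Machine.next
  change (P.machine.step s _).map _ = _
  rw [this]
  refine congrArg some (Machine.Config.eq_of rfl ?_ ?_ rfl)
  · funext i
    refine Fin.cases (n := 1) ?_ (fun j => ?_) i
    · exact ha
    · obtain rfl : j = 0 := Subsingleton.elim _ _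
      exact hb
  · funext i
    refine Fin.cases (n := 1) rfl (fun j => ?_) i
    obtain rfl : j = 0 := Subsingleton.elim _ _
    rfl

theorem next_conf_eq_none {P : Sweeper I X} {s : P.State} {a b : List (I ⊕ P.Cell)} {h h' : ℕ}
    {out : List X} (hs : P.step s a[h]? b[h']? = none) :
    P.machine.next (P.conf s a h b h' out) = none := by
  unfold Machine.next
  have : P.machine.step s (fun i => (P.conf s a h b h' out).tape i
      ((P.conf s a h b h' out).head i)) = none := by
    change (P.step s a[h]? b[h']?).map _ = _
    rw [hs]
    rfl
  change (P.machine.step s _).map _ = _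
  rw [this]
  rfl

/-- The guard for the space bound on inputs of length `n`. -/
def Within (P : Sweeper I X) (n : ℕ) (c : P.machine.Config) : Prop :=
  c.head (0 : Fin 2) < n + 1 ∧ c.head (1 : Fin 2) < n + 2

theorem within_conf {P : Sweeper I X} {n : ℕ} {s : P.State} {a b : List (I ⊕ P.Cell)} {h h' : ℕ}
    {out : List X} (hh : h < n + 1) (hh' : h' < n + 2) : P.Within n (P.conf s a h b h' out) :=
  ⟨hh, hh'⟩

theorem run_tail {P : Sweeper I X} {n : ℕ} {s s' : P.State} {a a' b b' : List (I ⊕ P.Cell)}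
    {h h' k k' : ℕ} {x y : Option (I ⊕ P.Cell)} {m m' : Move} {out o out' : List X}
    {c : P.machine.Config} (hc : P.machine.Run (P.Within n) c (P.conf s a h b h' out))
    (hs : P.step s a[h]? b[h']? = some (s', (x, m), (y, m'), o))
    (ha : Function.update (fun n => a[n]?) h x = fun n => a'[n]?)
    (hb : Function.update (fun n => b[n]?) h' y = fun n => b'[n]?)
    (hm : m.apply h = k) (hm' : m'.apply h' = k') (ho : out ++ o = out')
    (hk : k < n + 1) (hk' : k' < n + 2) :
    P.machine.Run (P.Within n) c (P.conf s' a' k b' k' out') := by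
  subst hm hm' ho
  exact hc.tail (next_conf hs ha hb) (within_conf hk hk')

/-- The word as written on tape `0`. -/
abbrev plain (P : Sweeper I X) (u : List (I × P.E)) : List (I ⊕ P.Cell) :=
  u.map fun x => P.cell x.1 x.2 none

/-- The word with the values attached, as written on tape `0`. -/
abbrev marked (P : Sweeper I X) (y : List (I × P.E × P.R)) : List (I ⊕ P.Cell) :=
  y.map fun x => P.cell x.1 x.2.1 (some x.2.2)

/-- The stack as written on tape `1`. -/
abbrev stack (P : Sweeper I X) (s : List P.R) : List (I ⊕ P.Cell) := s.reverse.map P.stk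

theorem run_load (P : Sweeper I X) {n : ℕ} (v w : List I) (hn : v.length + w.length = n) :
    P.machine.Run (P.Within n)
      (P.conf .load (P.plain (v.map (·, P.zero)) ++ w.map .inl) v.length [] 0 [])
      (P.conf (.up P.start P.bot) (P.plain ((v ++ w).map (·, P.zero))) (n - 1) [] 0 []) := by
  induction w generalizing v with
  | nil =>
    refine .head (within_conf (by simp at hn; omega) (by omega)) (next_conf (s' := .up P.start P.bot)
      (a' := P.plain (v.map (·, P.zero)) ++ []) (x := none) (y := none) (m := .left) (m' := .stay)
      (b' := []) (o := []) ?_ ?_ ?_) ?_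
    · simp [step]
    · simp
    · simp
    · simp only [List.length_nil, Nat.add_zero] at hn
      subst hn
      simp only [List.append_nil, Move.apply]
      exact .refl (within_conf (by omega) (by omega))
  | cons i w ih =>
    refine .head (within_conf (by simp at hn; omega) (by omega)) (next_conf (s' := .load)
      (a' := P.plain (v.map (·, P.zero)) ++ P.cell i P.zero none :: w.map .inl)
      (x := some (P.cell i P.zero none)) (y := none) (m := .right) (m' := .stay)
      (b' := []) (o := []) ?_ ?_ ?_) ?_
    · simp [step]
    · have := update_getElem?_append (P.plain (v.map (·, P.zero))) (w.map Sum.inl) (.inl i)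
        (P.cell i P.zero none)
      simpa using this
    · simp
    · have := ih (v ++ [i]) (by simp at hn ⊢; omega)
      simpa [Move.apply] using this

/-- The top `r` of the stack is held in the control state; tape `1` holds the rest, with the head on
the first blank cell after it. The truncated `v.length - 1` agrees with the rule that a left move
has no effect in the leftmost cell: after the last symbol the head stays in cell `0` and scans a
cell that already carries a value, which is how the machine detects the end of the sweep. -/
theorem run_up {P : Sweeper I X} {n : ℕ} {c : P.C} {out : List X} {u y r s}
    (h : P.Eval u y (r :: s)) (v : List (I × P.E)) (hn : v.length + u.length = n) :
    P.machine.Run (P.Within n)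
      (P.conf (.up c P.bot) (P.plain (v ++ u)) (n - 1) [] 0 out)
      (P.conf (.up c r) (P.plain v ++ P.marked y) (v.length - 1) (P.stack s) s.length out) := by
  generalize hs : r :: s = st at h
  induction h generalizing v r s with
  | nil =>
    obtain ⟨rfl, rfl⟩ := List.cons.inj hs
    simp only [List.length_nil, Nat.add_zero] at hn
    subst hn
    simp only [List.append_nil, List.map_nil, List.length_nil]
    exact .refl (within_conf (by omega) (by omega))
  | @leaf u y st i e hi hu ih =>
    obtain ⟨rfl, rfl⟩ := List.cons.inj hs
    have hl := hu.length_stack_le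
    obtain ⟨r, st, rfl⟩ : ∃ r s', s = r :: s' := by
      cases hu <;> exact ⟨_, _, rfl⟩
    have := ih (v ++ [(i, e)]) (by simp at hn ⊢; omega) rfl
    simp only [List.append_assoc, List.singleton_append, List.length_append, List.length_singleton,
      Nat.add_sub_cancel] at this
    simp only [List.length_cons] at hl hn
    refine run_tail this (x := some (P.cell i e (some (P.comb i e P.bot P.bot))))
      (y := some (P.stk r)) (m := .left) (m' := .right) (o := []) (by simp [step, hi]) ?_ ?_
      (by simp [Move.apply]) (by simp [Move.apply]) (by simp) (by omega) (by simp; omega)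
    · have := update_getElem?_append (P.plain v) (P.marked y) (P.cell i e none)
        (P.cell i e (some (P.comb i e P.bot P.bot)))
      simpa using this
    · have := update_getElem?_length (P.stack st) (P.stk r)
      simpa using this
  | @unary u y r' st i e hi hu ih =>
    obtain ⟨rfl, rfl⟩ := List.cons.inj hs
    have hl := hu.length_stack_le
    have := ih (v ++ [(i, e)]) (by simp at hn ⊢; omega) rfl
    simp only [List.append_assoc, List.singleton_append, List.length_append, List.length_singleton,
      Nat.add_sub_cancel] at this
    simp only [List.length_cons] at hl hn
    refine run_tail this (x := some (P.cell i e (some (P.comb i e r' P.bot))))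
      (y := (P.stack s)[s.length]?) (m := .left) (m' := .stay) (o := []) (by simp [step, hi]) ?_
      (by simp) (by simp [Move.apply]) (by simp [Move.apply]) (by simp) (by omega) (by omega)
    have := update_getElem?_append (P.plain v) (P.marked y) (P.cell i e none)
      (P.cell i e (some (P.comb i e r' P.bot)))
    simpa using this
  | @binary u y r₁ r₂ st i e hi hu ih =>
    obtain ⟨rfl, rfl⟩ := List.cons.inj hs
    have hl := hu.length_stack_le
    have := ih (v ++ [(i, e)]) (by simp at hn ⊢; omega) rfl
    simp only [List.append_assoc, List.singleton_append, List.length_append, List.length_cons,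
      List.length_nil, Nat.zero_add, Nat.add_sub_cancel] at this
    simp only [List.length_cons] at hl hn
    -- A binary symbol takes two steps, because the second argument becomes visible only after the
    -- stack head has moved back onto it.
    have h2 : P.machine.Run (P.Within n) _
        (P.conf (.pop c r₁) (P.plain (v ++ [(i, e)]) ++ P.marked y) v.length
        (P.stack (r₂ :: s)) s.length out) :=
      run_tail this (x := some (P.cell i e none)) (y := none) (m := .stay) (m' := .left) (o := [])
        (by simp [step, hi]) (by simp) (by simp) (by simp [Move.apply]) (by simp [Move.apply])
        (by simp) (by omega) (by omega)
    refine run_tail h2 (x := some (P.cell i e (some (P.comb i e r₁ r₂)))) (y := none) (m := .left)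
      (m' := .stay) (o := []) (by simp [step]) ?_ ?_ (by simp [Move.apply]) (by simp [Move.apply])
      (by simp) (by omega) (by omega)
    · have := update_getElem?_append (P.plain v) (P.marked y) (P.cell i e none)
        (P.cell i e (some (P.comb i e r₁ r₂)))
      simpa using this
    · have := update_getElem?_none (P.stack s) (P.stk r₂)
      simpa using this

theorem run_down (P : Sweeper I X) {n : ℕ} (l : P.L) (v : List (I × P.E))
    (y : List (I × P.E × P.R)) (hn : v.length + y.length = n) (out : List X) :
    P.machine.Run (P.Within n)
      (P.conf (.down l) (P.plain v ++ P.marked y) v.length [] 0 out)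
      (P.conf (.down (P.pass l y).1) (P.plain (v ++ (P.pass l y).2.1)) n [] 0
        (out ++ (P.pass l y).2.2)) := by
  induction y generalizing v l out with
  | nil =>
    simp only [List.length_nil, Nat.add_zero] at hn
    subst hn
    simp only [pass, List.append_nil, List.map_nil]
    exact .refl (within_conf (by omega) (by omega))
  | cons a y ih =>
    obtain ⟨i, e, r⟩ := a
    simp only [List.length_cons] at hn
    refine .head (within_conf (by omega) (by omega)) (next_conf (s' := .down (P.move l i e r).1)
      (a' := P.plain v ++ P.cell i (P.move l i e r).2.1 none :: P.marked y)
      (x := some (P.cell i (P.move l i e r).2.1 none)) (y := none) (m := .right) (m' := .stay)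
      (b' := []) (o := (P.move l i e r).2.2) ?_ ?_ ?_) ?_
    · simp [step]
    · have := update_getElem?_append (P.plain v) (P.marked y) (P.cell i e (some r))
        (P.cell i (P.move l i e r).2.1 none)
      simpa using this
    · simp
    · have := ih (P.move l i e r).1 (v ++ [(i, (P.move l i e r).2.1)])
        (by simp; omega) (out ++ (P.move l i e r).2.2)
      simpa [Move.apply, pass] using this

theorem run_round (P : Sweeper I X) {n : ℕ} {c : P.C} {u y r} (h : P.Eval u y [r, P.bot])
    (hn : u.length = n) (out : List X) :
    P.machine.Run (P.Within n)
      (P.conf (.up c P.bot) (P.plain u) (n - 1) [] 0 out)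
      (P.conf (.down (P.pass (P.begin c r).1 y).1) (P.plain (P.pass (P.begin c r).1 y).2.1) n [] 0
        (out ++ ((P.begin c r).2 ++ (P.pass (P.begin c r).1 y).2.2))) := by
  have hy := h.length_eq
  -- The stack holds two values, so the word is not empty and cell `0` carries a value.
  obtain ⟨⟨i, e, r'⟩, y', rfl⟩ : ∃ a y', y = a :: y' := by
    cases h <;> exact ⟨_, _, rfl⟩
  have h1 := run_up (c := c) (out := out) h [] (by simpa using hn)
  simp only [List.nil_append, List.map_nil, List.length_nil, List.length_singleton,
    Nat.zero_sub] at h1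
  set y := (i, e, r') :: y' with hydef
  have h2 : P.machine.Run (P.Within n) (P.conf (.up c P.bot) (P.plain u) (n - 1) [] 0 out)
      (P.conf (.turn c r) (P.marked y) 0 (P.stack [P.bot]) 0 out) := by
    refine run_tail h1 (x := some (P.cell i e (some r'))) (y := none) (m := .stay) (m' := .left)
      (o := []) (by simp [step, hydef]) ?_ ?_ rfl rfl (by simp) (by omega) (by omega)
    · rw [Function.update_eq_self_iff]; simp [hydef]
    · rw [Function.update_eq_self_iff]; simp
  -- Only the bottom element is left on tape `1`; erasing it leaves the tape blank for the next
  -- round.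
  have h3 : P.machine.Run (P.Within n) (P.conf (.up c P.bot) (P.plain u) (n - 1) [] 0 out)
      (P.conf (.down (P.begin c r).1) (P.marked y) 0 [] 0 (out ++ (P.begin c r).2)) := by
    refine run_tail h2 (x := some (P.cell i e (some r'))) (y := none) (m := .stay) (m' := .stay)
      (o := (P.begin c r).2) (by simp [step, hydef]) ?_ (update_getElem?_none [] (P.stk P.bot))
      rfl rfl rfl (by omega) (by omega)
    rw [Function.update_eq_self_iff]; simp [hydef]
  have h4 := P.run_down (n := n) (P.begin c r).1 [] y (by simp; omega) (out ++ (P.begin c r).2)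
  simpa using h3.trans h4

theorem Rounds.run {P : Sweeper I X} {n : ℕ} {c : P.C} {u out} (h : P.Rounds c u out)
    (hn : u.length = n) (out' : List X) :
    ∃ d, P.machine.Run (P.Within n) (P.conf (.up c P.bot) (P.plain u) (n - 1) [] 0 out') d ∧
      P.machine.next d = none ∧ d.out = out' ++ out := by
  induction h generalizing out' with
  | @last c u y r h hf =>
    refine ⟨_, P.run_round h hn out', next_conf_eq_none ?_, rfl⟩
    have : (P.pass (P.begin c r).1 y).2.1.length = n := by
      rw [length_pass, h.length_eq, hn]
    simp [step, this, hf]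
  | @more c u y r c' out h hf _ ih =>
    have hl : (P.pass (P.begin c r).1 y).2.1.length = n := by
      rw [length_pass, h.length_eq, hn]
    obtain ⟨d, hd, hd', hd''⟩ := ih hl
      (out' ++ ((P.begin c r).2 ++ (P.pass (P.begin c r).1 y).2.2))
    refine ⟨d, (P.run_round h hn out').trans (.head (within_conf (by omega) (by omega))
      (next_conf (s' := .up c' P.bot) (x := none) (y := none) (m := .left) (m' := .stay)
      (a' := P.plain (P.pass (P.begin c r).1 y).2.1) (b' := []) (o := []) ?_ ?_ ?_) ?_), hd', ?_⟩
    · simp [step, hl, hf]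
    · rw [Function.update_eq_self_iff]; simp [hl]
    · simp
    · simpa [Move.apply] using hd
    · simp [hd'']

/-- The machine executes the sweeper, in linear space. -/
theorem Rounds.machine_spec {P : Sweeper I X} {w : List I} {out : List X}
    (h : P.Rounds P.start (w.map (·, P.zero)) out) :
    P.machine.HaltsWith w out ∧ P.machine.UsesSpace w (2 * w.length + 3) := by
  obtain ⟨d, hd, hd', hd''⟩ := h.run (n := w.length) (by simp) []
  have h0 := P.run_load (n := w.length) [] w (by simp)
  have hr : P.machine.Run (P.Within w.length) (P.machine.initial w) d := by
    rw [initial_eq_conf]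
    exact Machine.Run.trans (by simpa using h0) hd
  -- Tape `0` needs the word and the blank after it; on tape `1` the head never passes the end of a
  -- stack of at most `w.length + 1` values.
  let b : Fin 2 → ℕ := ![w.length + 1, w.length + 2]
  refine ⟨⟨d, hr.reaches, hd', by simpa using hd''⟩, b, ?_, ?_⟩
  · refine (Fin.sum_univ_two b).trans_le ?_
    simp only [b, Matrix.cons_val_zero, Matrix.cons_val_one]
    omega
  · intro c hc i
    have := hr.forall_reaches hd' hc
    refine Fin.cases (n := 1) this.1 (fun j => ?_) i
    obtain rfl : j = 0 := Subsingleton.elim _ _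
    exact this.2

end Sweeper

/-! ## Enumerations -/

/-- Starting from `a` and iterating `f`, the elements of the list are met, and then `f` is
undefined. -/
inductive Enumerates {α : Type} (f : α → Option α) : α → List α → Prop
  | last {a : α} : f a = none → Enumerates f a [a]
  | cons {a b : α} {l : List α} : f a = some b → Enumerates f b l → Enumerates f a (a :: l)

theorem Enumerates.congr {α : Type} {f g : α → Option α} {a : α} {l : List α}
    (h : Enumerates f a l) (hfg : ∀ b ∈ l, g b = f b) : Enumerates g a l := by
  induction h with
  | last h => exact .last (by rw [hfg _ (by simp), h])
  | cons h _ ih =>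
    exact .cons (by rw [hfg _ (by simp), h]) (ih fun b hb => hfg b (List.mem_cons_of_mem _ hb))

theorem exists_enumerates_of_nodup {α : Type} (a : α) (l : List α) (h : (a :: l).Nodup) :
    ∃ f, Enumerates f a (a :: l) := by
  classical
  induction l generalizing a with
  | nil => exact ⟨fun _ => none, .last rfl⟩
  | cons b l ih =>
    rw [List.nodup_cons] at h
    obtain ⟨f, hf⟩ := ih b h.2
    refine ⟨Function.update f a (some b), .cons (by simp) (hf.congr fun c hc => ?_)⟩
    rw [Function.update_of_ne]
    rintro rfl
    exact h.1 hc

/-- Supplies the successor tables for digits and for kinds. Neither depends on a formula, so they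
can be built into the finite control of one machine. -/
theorem exists_enumerates {α : Type} [Finite α] (a : α) :
    ∃ (f : α → Option α) (l : List α), Enumerates f a (a :: l) ∧ (a :: l).Nodup ∧
      ∀ b, b ∈ a :: l := by
  classical
  have := Fintype.ofFinite α
  have h : (a :: (Finset.univ.erase a).toList).Nodup := by
    simp [Finset.nodup_toList]
  obtain ⟨f, hf⟩ := exists_enumerates_of_nodup a _ h
  refine ⟨f, _, hf, h, fun b => ?_⟩
  by_cases hb : b = a <;> simp [hb]

/-- Increment a word of digits, least significant digit first, if the carry is set; the result is
the new carry and the new word. -/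
def increment {E : Type} (succ : E → Option E) (zero : E) : Bool → List E → Bool × List E
  | c, [] => (c, [])
  | false, es => (false, es)
  | true, e :: es =>
    match succ e with
    | some e' => (false, e' :: es)
    | none => ((increment succ zero true es).1, zero :: (increment succ zero true es).2)

@[simp]
theorem increment_false {E : Type} (succ : E → Option E) (zero : E) (es : List E) :
    increment succ zero false es = (false, es) := by
  cases es <;> rfl

/-- The next word of the same length. -/
def succWord {E : Type} (succ : E → Option E) (zero : E) (es : List E) : Option (List E) :=
  if (increment succ zero true es).1 then none else some (increment succ zero true es).2

/-- An overflow resets the counter by itself, so the next enumeration of words starts without a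
separate clearing pass. -/
theorem increment_of_overflow {E : Type} (succ : E → Option E) (zero : E) (es : List E)
    (h : (increment succ zero true es).1 = true) :
    (increment succ zero true es).2 = List.replicate es.length zero := by
  induction es with
  | nil => rfl
  | cons e es ih =>
    rw [increment] at h ⊢
    cases hs : succ e with
    | none =>
      simp only [hs] at h ⊢
      simp [ih h, List.replicate_succ]
    | some e' => simp [hs] at h

theorem length_increment {E : Type} (succ : E → Option E) (zero : E) (c : Bool) (es : List E) :
    (increment succ zero c es).2.length = es.length := by
  induction es generalizing c with
  | nil => cases c <;> rfl
  | cons e es ih =>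
    cases c with
    | false => simp
    | true =>
      rw [increment]
      cases succ e <;> simp [ih]

/-- The least significant digit stands first, so it runs through all of `l` while the tail `es`
stays fixed. Here the tail is the last one; in `Enumerates.succWord_append` the carry moves on to
the next tail. -/
theorem Enumerates.succWord_last {E : Type} {succ : E → Option E} {zero e : E} {l : List E}
    (h : Enumerates succ e l) {es : List E} (hes : succWord succ zero es = none) :
    Enumerates (succWord succ zero) (e :: es) (l.map (· :: es)) := by
  induction h with
  | last h =>
    refine .last ?_
    unfold succWord at hes ⊢
    rw [increment, h]
    simpa using hes
  | cons h _ ih =>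
    refine .cons ?_ ih
    rw [succWord, increment, h]
    simp

theorem Enumerates.succWord_append {E : Type} {succ : E → Option E} {zero e : E} {l : List E}
    (h : Enumerates succ e l) {es es' : List E} (hes : succWord succ zero es = some es')
    {l' : List (List E)} (h' : Enumerates (succWord succ zero) (zero :: es') l') :
    Enumerates (succWord succ zero) (e :: es) (l.map (· :: es) ++ l') := by
  induction h with
  | last h =>
    refine .cons ?_ h'
    unfold succWord at hes ⊢
    rw [increment, h]
    simp at hes ⊢
    exact hes
  | cons h _ ih =>
    refine .cons ?_ ih
    rw [succWord, increment, h]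
    simp

theorem Enumerates.words {E : Type} {succ : E → Option E} {zero : E} {l : List E}
    (h : Enumerates succ zero l) (hl : l.Nodup) (hmem : ∀ e, e ∈ l) (n : ℕ) :
    ∃ ws, Enumerates (succWord succ zero) (List.replicate n zero) ws ∧ ws.Nodup ∧
      ∀ es, es ∈ ws ↔ es.length = n := by
  induction n with
  | zero =>
    refine ⟨[[]], .last rfl, by simp, fun es => ?_⟩
    simp
  | succ n ih =>
    obtain ⟨ws, hws, hnd, hw⟩ := ih
    refine ⟨ws.flatMap fun es => l.map (· :: es), ?_, ?_, fun es => ?_⟩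
    · rw [List.replicate_succ]
      generalize List.replicate n zero = es at hws
      clear hnd hw
      induction hws with
      | last h' => simpa using h.succWord_last h'
      | cons h' _ ih => exact h.succWord_append h' ih
    · rw [List.nodup_flatMap]
      refine ⟨fun es _ => hl.map fun a b hab => (List.cons.inj hab).1, ?_⟩
      refine hnd.imp fun {a b} hab => ?_
      simp only [Function.onFun]
      intro x hx hx'
      simp only [List.mem_map] at hx hx'
      obtain ⟨_, _, rfl⟩ := hx
      obtain ⟨_, _, h⟩ := hx'
      exact hab (List.cons.inj h).2.symm
    · cases es with
      | nil => simp
      | cons e es => simp [hw, hmem]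

/-! ## The automaton of a formula -/

section Semantics
variable {V Ch D K CV : Type}

/-- Structural induction on formulas. -/
@[elab_as_elim]
theorem Formula.structural {P : Formula V Ch D K CV → Prop} (var : ∀ v, P (.var v))
    (nvar : ∀ v, P (.nvar v)) (or : ∀ φ ψ, P φ → P ψ → P (.or φ ψ))
    (and : ∀ φ ψ, P φ → P ψ → P (.and φ ψ)) (strongUntil : ∀ φ ψ, P φ → P ψ → P (.until φ ψ))
    (release : ∀ φ ψ, P φ → P ψ → P (.release φ ψ))
    (possible : ∀ O φ, P φ → P (.possible O φ)) (necessary : ∀ O φ, P φ → P (.necessary O φ))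
    (φ : Formula V Ch D K CV) : P φ :=
  φ.rec var nvar or and strongUntil release possible necessary

/-- The local conditions on consecutive states `q`, `q'` of the automaton at letter `a`, for the
subformula that stands at position `p`. The first bit of a state at a position is an obligation to
fulfil the subformula there; the second bit, used for untils, tells whether the until has been free
of pending obligations at some time since the last visit to an accepting state; `fin` says that `q`
is accepting. -/
def Formula.Step (a : (V → Bool) × Observation Ch D K CV) (fin : Prop) (q q' : ℕ → Bool × Bool) :
    Formula V Ch D K CV → ℕ → Prop
  | .var v, p => (q p).1 = true → a.1 v = true
  | .nvar v, p => (q p).1 = true → ¬ a.1 v = true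
  | .or φ ψ, p => ((q p).1 = true → (q (p + 1)).1 = true ∨ (q (p + 1 + φ.size)).1 = true) ∧
      φ.Step a fin q q' (p + 1) ∧ ψ.Step a fin q q' (p + 1 + φ.size)
  | .and φ ψ, p => ((q p).1 = true → (q (p + 1)).1 = true ∧ (q (p + 1 + φ.size)).1 = true) ∧
      φ.Step a fin q q' (p + 1) ∧ ψ.Step a fin q q' (p + 1 + φ.size)
  | .until φ ψ, p => (((q p).1 = true → (q (p + 1 + φ.size)).1 = true ∨
        ((q (p + 1)).1 = true ∧ (q' p).1 = true)) ∧
      ((q' p).2 = true → ((q' p).1 = true → (q' (p + 1 + φ.size)).1 = true) ∨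
        ((q p).2 = true ∧ ¬ fin))) ∧
      φ.Step a fin q q' (p + 1) ∧ ψ.Step a fin q q' (p + 1 + φ.size)
  | .release φ ψ, p => ((q p).1 = true → (q (p + 1 + φ.size)).1 = true ∧
        ((q (p + 1)).1 = true ∨ (q' p).1 = true)) ∧
      φ.Step a fin q q' (p + 1) ∧ ψ.Step a fin q q' (p + 1 + φ.size)
  | .possible O φ, p =>
      ((q p).1 = true → O.Sat a.2 ∧ (q' (p + 1 + (O.word (V := V)).length)).1 = true) ∧
      φ.Step a fin q q' (p + 1 + (O.word (V := V)).length)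
  | .necessary O φ, p =>
      ((q p).1 = true → O.Sat a.2 → (q' (p + 1 + (O.word (V := V)).length)).1 = true) ∧
      φ.Step a fin q q' (p + 1 + (O.word (V := V)).length)

/-- The entry of a state at a position. -/
def entry (l : List (Bool × Bool)) (p : ℕ) : Bool × Bool := l.getD p (false, false)

/-- The accepting states: all second bits are set. -/
def Final (l : List (Bool × Bool)) : Prop := ∀ p < l.length, (entry l p).2 = true

/-- The automaton of a formula. -/
def Formula.automaton (φ : Formula V Ch D K CV) : NBW φ.Letter where
  Q := List.Vector (Bool × Bool) φ.size
  finite_Q := inferInstance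
  init := {q | (entry q.1 0).1 = true}
  -- A letter realized by no observation has no transitions; a word containing it is satisfied by no
  -- computation anyway.
  δ q a := {q' | ∃ m, a.2 = {O | O.1.Sat m} ∧
    φ.Step (a.1, m) (Final q.1) (entry q.1) (entry q'.1) 0}
  F := {q | Final q.1}

/-- The local conditions see an observation only through the top-level descriptors it satisfies.
Hence the witness `m` in the transition relation can be exchanged for any observation with the same
letter. -/
theorem Formula.step_congr {φ : Formula V Ch D K CV} {σ : V → Bool} {m m' : Observation Ch D K CV}
    (h : ∀ O ∈ φ.descriptors, O.Sat m ↔ O.Sat m') {fin : Prop} {q q' : ℕ → Bool × Bool} {p : ℕ} :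
    φ.Step (σ, m) fin q q' p ↔ φ.Step (σ, m') fin q q' p := by
  induction φ using Formula.structural generalizing p with
  | var v => rfl
  | nvar v => rfl
  | or φ ψ ih₁ ih₂ | and φ ψ ih₁ ih₂ | strongUntil φ ψ ih₁ ih₂ | release φ ψ ih₁ ih₂ =>
    simp only [Formula.descriptors, List.mem_append] at h
    simp only [Formula.Step, ih₁ fun O hO => h O (.inl hO), ih₂ fun O hO => h O (.inr hO)]
  | possible O φ ih | necessary O φ ih =>
    simp only [Formula.descriptors, List.mem_cons] at h
    simp only [Formula.Step, ih fun O hO => h O (.inr hO), h O (.inl rfl)]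

/-! ### Breakpoints -/

/-- Read `d` as "nothing pending", `e` as the second bit and `f` as acceptance. If `d` failed from
time `i` on, the bit would be lost right after the next accepting state and could never be regained,
but a later accepting state needs it. -/
theorem frequently_of_breakpoints {d e f : ℕ → Prop} (hf : ∃ᶠ i in Filter.atTop, f i)
    (hfe : ∀ i, f i → e i) (he : ∀ i, e (i + 1) → d (i + 1) ∨ (e i ∧ ¬ f i)) (i : ℕ) :
    ∃ j, i ≤ j ∧ d j := by
  by_contra! h
  obtain ⟨a, hia, ha⟩ := Filter.frequently_atTop.1 hf i
  obtain ⟨b, hab, hb⟩ := Filter.frequently_atTop.1 hf (a + 1)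
  have key : ∀ k, ¬ e (a + 1 + k) := by
    intro k
    induction k with
    | zero =>
      intro hk
      rcases he a hk with h' | h'
      · exact h _ (by omega) h'
      · exact h'.2 ha
    | succ k ih =>
      intro hk
      rcases he (a + 1 + k) hk with h' | h'
      · exact h (a + 1 + k + 1) (by omega) h'
      · exact ih h'.1
  obtain ⟨k, rfl⟩ := Nat.exists_eq_add_of_le hab
  exact key k (hfe _ hb)

/-- The positions below `n` that have been discharged since the last time when all had been. -/
def sinceBreak (n : ℕ) (d : ℕ → ℕ → Prop) : ℕ → ℕ → Prop
  | 0, _ => True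
  | i + 1, p => d (i + 1) p ∨ (sinceBreak n d i p ∧ ¬ ∀ k < n, sinceBreak n d i k)

/-- If breakpoints stopped, no bit would be reset any more. Each bit would then be set at the next
discharge of its position and stay set, and with finitely many positions all would be set at once: a
breakpoint. -/
theorem frequently_sinceBreak {n : ℕ} {d : ℕ → ℕ → Prop} (hd : ∀ p i, ∃ j, i ≤ j ∧ d j p) :
    ∃ᶠ i in Filter.atTop, ∀ k < n, sinceBreak n d i k := by
  by_contra h
  rw [Filter.not_frequently] at h
  obtain ⟨a, ha⟩ := Filter.eventually_atTop.1 h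
  have key : ∀ p, ∀ᶠ i in Filter.atTop, sinceBreak n d i p := by
    intro p
    obtain ⟨j, haj, hj⟩ := hd p (a + 1)
    refine Filter.eventually_atTop.2 ⟨j, fun i hi => ?_⟩
    induction i, hi using Nat.le_induction with
    | base =>
      obtain ⟨j, rfl⟩ : ∃ j', j = j' + 1 := ⟨j - 1, by omega⟩
      exact .inl hj
    | succ i hi ih => exact .inr ⟨ih, ha i (by omega)⟩
  have all : ∀ᶠ i in Filter.atTop, ∀ k ∈ Set.Iio n, sinceBreak n d i k :=
    (Filter.eventually_all_finite (Set.finite_Iio n)).2 fun p _ => key p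
  obtain ⟨i, hi, hi'⟩ := (h.and all).exists
  exact hi hi'

/-- Pigeonhole: acceptance asks for one state of `F` that recurs, not just for recurring visits to
`F`. -/
theorem exists_frequently_eq {Q : Type} [Finite Q] {F : Set Q} {r : ℕ → Q}
    (h : ∃ᶠ i in Filter.atTop, r i ∈ F) : ∃ q ∈ F, ∃ᶠ i in Filter.atTop, r i = q := by
  by_contra! hc
  refine h ?_
  have : ∀ᶠ i in Filter.atTop, ∀ q ∈ F, ¬ r i = q :=
    (Filter.eventually_all_finite (Set.toFinite F)).2 fun q hq => hc q hq
  exact this.mono fun i hi hF => hi _ hF rfl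

/-! ### Soundness -/

/-- Induction on the formula, with the position general so that one run serves all subformulas. Only
until uses acceptance: the breakpoints yield a later time with nothing pending, and the obligation
is propagated up to that time unless it is fulfilled before. -/
theorem Formula.satAt_of_step (φ : Formula V Ch D K CV) (ρ : Computation V Ch D K CV)
    (q : ℕ → ℕ → Bool × Bool) (fin : ℕ → Prop) (hinf : ∃ᶠ i in Filter.atTop, fin i) (p : ℕ)
    (hfin : ∀ i, fin i → ∀ k < φ.size, (q i (p + k)).2 = true)
    (hstep : ∀ i, φ.Step (ρ i) (fin i) (q i) (q (i + 1)) p) (i : ℕ) (hi : (q i p).1 = true) :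
    φ.SatAt ρ i := by
  induction φ using Formula.structural generalizing p i with
  | var v => exact hstep i hi
  | nvar v => exact hstep i hi
  | or φ ψ ih₁ ih₂ =>
    have hs : (Formula.or φ ψ).size = 1 + φ.size + ψ.size := by
      simp [Formula.size, Formula.word]; omega
    have h₁ := ih₁ (p + 1) (fun i h k hk => by
      have := hfin i h (1 + k) (by omega); rwa [← add_assoc] at this) fun i => (hstep i).2.1
    have h₂ := ih₂ (p + 1 + φ.size) (fun i h k hk => by
      have := hfin i h (1 + φ.size + k) (by omega); simpa only [← add_assoc] using this)
      fun i => (hstep i).2.2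
    exact ((hstep i).1 hi).imp (h₁ i) (h₂ i)
  | and φ ψ ih₁ ih₂ =>
    have hs : (Formula.and φ ψ).size = 1 + φ.size + ψ.size := by
      simp [Formula.size, Formula.word]; omega
    have h₁ := ih₁ (p + 1) (fun i h k hk => by
      have := hfin i h (1 + k) (by omega); rwa [← add_assoc] at this) fun i => (hstep i).2.1
    have h₂ := ih₂ (p + 1 + φ.size) (fun i h k hk => by
      have := hfin i h (1 + φ.size + k) (by omega); simpa only [← add_assoc] using this)
      fun i => (hstep i).2.2
    exact ((hstep i).1 hi).imp (h₁ i) (h₂ i)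
  | strongUntil φ ψ ih₁ ih₂ =>
    have hs : (Formula.until φ ψ).size = 1 + φ.size + ψ.size := by
      simp [Formula.size, Formula.word]; omega
    have h₁ := ih₁ (p + 1) (fun i h k hk => by
      have := hfin i h (1 + k) (by omega); rwa [← add_assoc] at this) fun i => (hstep i).2.1
    have h₂ := ih₂ (p + 1 + φ.size) (fun i h k hk => by
      have := hfin i h (1 + φ.size + k) (by omega); simpa only [← add_assoc] using this)
      fun i => (hstep i).2.2
    obtain ⟨j, hij, hj⟩ := frequently_of_breakpoints hinf
      (d := fun i => (q i p).1 = true → (q i (p + 1 + φ.size)).1 = true)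
      (e := fun i => (q i p).2 = true) (fun i h => hfin i h 0 (by omega))
      (fun i => (hstep i).1.2) i
    -- Induction on the distance to the discharge time, where the obligation, if still present,
    -- forces `ψ`.
    obtain ⟨k, rfl⟩ := Nat.exists_eq_add_of_le hij
    clear hij
    induction k generalizing i with
    | zero => exact ⟨i, le_rfl, h₂ i (hj hi), fun k _ _ => by omega⟩
    | succ k ih =>
      rcases (hstep i).1.1 hi with h | ⟨h, h'⟩
      · exact ⟨i, le_rfl, h₂ i h, fun k _ _ => by omega⟩
      · obtain ⟨j, hj₁, hj₂, hj₃⟩ := ih (i + 1) h' (by rwa [show i + 1 + k = i + (k + 1) by omega])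
        refine ⟨j, by omega, hj₂, fun l hl hl' => ?_⟩
        rcases hl.eq_or_lt with rfl | hl
        · exact h₁ _ h
        · exact hj₃ l hl hl'
  | release φ ψ ih₁ ih₂ =>
    have hs : (Formula.release φ ψ).size = 1 + φ.size + ψ.size := by
      simp [Formula.size, Formula.word]; omega
    have h₁ := ih₁ (p + 1) (fun i h k hk => by
      have := hfin i h (1 + k) (by omega); rwa [← add_assoc] at this) fun i => (hstep i).2.1
    have h₂ := ih₂ (p + 1 + φ.size) (fun i h k hk => by
      have := hfin i h (1 + φ.size + k) (by omega); simpa only [← add_assoc] using this)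
      fun i => (hstep i).2.2
    intro j hij
    obtain ⟨k, rfl⟩ := Nat.exists_eq_add_of_le hij
    clear hij
    induction k generalizing i with
    | zero => exact .inl (h₂ i ((hstep i).1 hi).1)
    | succ k ih =>
      rcases ((hstep i).1 hi).2 with h | h
      · exact .inr ⟨i, le_rfl, by omega, h₁ i h⟩
      · rw [show i + (k + 1) = i + 1 + k by omega]
        refine (ih (i + 1) h).imp id ?_
        rintro ⟨l, hl, hl', h⟩
        exact ⟨l, by omega, hl', h⟩
  | possible O φ ih | necessary O φ ih =>
    have h := ih (p + 1 + (O.word (V := V)).length) (fun i h k hk => by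
      have := hfin i h (1 + (O.word (V := V)).length + k)
        (by simp [Formula.size, Formula.word] at hk ⊢; omega)
      simpa only [← add_assoc] using this) fun i => (hstep i).2
    first
    | exact ((hstep i).1 hi).imp id (h (i + 1))
    | exact fun hO => h (i + 1) ((hstep i).1 hi hO)

/-! ### Completeness -/

/-- The function that assigns `f χ` to the positions of subformulas `χ` and `d` to the positions
inside descriptors. -/
def Formula.label {α : Type} (f : Formula V Ch D K CV → α) (d : α) :
    Formula V Ch D K CV → ℕ → α
  | .var v, _ => f (.var v)
  | .nvar v, _ => f (.nvar v)
  | .or φ ψ, p => if p = 0 then f (.or φ ψ) else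
      if p - 1 < φ.size then φ.label f d (p - 1) else ψ.label f d (p - 1 - φ.size)
  | .and φ ψ, p => if p = 0 then f (.and φ ψ) else
      if p - 1 < φ.size then φ.label f d (p - 1) else ψ.label f d (p - 1 - φ.size)
  | .until φ ψ, p => if p = 0 then f (.until φ ψ) else
      if p - 1 < φ.size then φ.label f d (p - 1) else ψ.label f d (p - 1 - φ.size)
  | .release φ ψ, p => if p = 0 then f (.release φ ψ) else
      if p - 1 < φ.size then φ.label f d (p - 1) else ψ.label f d (p - 1 - φ.size)
  | .possible O φ, p => if p = 0 then f (.possible O φ) else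
      if p - 1 < (O.word (V := V)).length then d else
        φ.label f d (p - 1 - (O.word (V := V)).length)
  | .necessary O φ, p => if p = 0 then f (.necessary O φ) else
      if p - 1 < (O.word (V := V)).length then d else
        φ.label f d (p - 1 - (O.word (V := V)).length)

theorem Formula.label_zero {α : Type} (f : Formula V Ch D K CV → α) (d : α)
    (φ : Formula V Ch D K CV) : φ.label f d 0 = f φ := by
  cases φ <;> simp [Formula.label]

/-- The subformula `χ` at a position is found uniformly in the labelling, so the same `χ` serves at
all times. No bound on `p` is imposed, since `frequently_sinceBreak` asks for discharges at every
`p`. -/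
theorem Formula.label_cases (φ : Formula V Ch D K CV) (p : ℕ) :
    (∃ χ, ∀ (α : Type) (f : Formula V Ch D K CV → α) (d : α), φ.label f d p = f χ) ∨
      ∀ (α : Type) (f : Formula V Ch D K CV → α) (d : α), φ.label f d p = d := by
  induction φ using Formula.structural generalizing p with
  | var v | nvar v => exact .inl ⟨_, fun _ _ _ => rfl⟩
  | or φ ψ ih₁ ih₂ | and φ ψ ih₁ ih₂ | strongUntil φ ψ ih₁ ih₂ | release φ ψ ih₁ ih₂ =>
    simp only [Formula.label]
    split_ifs
    · exact .inl ⟨_, fun _ _ _ => rfl⟩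
    · exact ih₁ _
    · exact ih₂ _
  | possible O φ ih | necessary O φ ih =>
    simp only [Formula.label]
    split_ifs
    · exact .inl ⟨_, fun _ _ _ => rfl⟩
    · exact .inr fun _ _ _ => rfl
    · exact ih _

/-- No obligation from the until `χ` is pending at time `i`. -/
def Formula.Discharged (ρ : Computation V Ch D K CV) (i : ℕ) : Formula V Ch D K CV → Prop
  | .until φ ψ => (Formula.until φ ψ).SatAt ρ i → ψ.SatAt ρ i
  | _ => True

/-- An until that holds at `i` is discharged at its witness; one that fails at `i` has nothing
pending there. -/
theorem Formula.exists_discharged (ρ : Computation V Ch D K CV) (χ : Formula V Ch D K CV) (i : ℕ) :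
    ∃ j, i ≤ j ∧ χ.Discharged ρ j := by
  induction χ using Formula.structural with
  | strongUntil φ ψ =>
    by_cases h : (Formula.until φ ψ).SatAt ρ i
    · obtain ⟨j, hj, hψ, _⟩ := h
      exact ⟨j, hj, fun _ => hψ⟩
    · exact ⟨i, le_rfl, fun h' => absurd h' h⟩
  | _ => exact ⟨i, le_rfl, trivial⟩

theorem Formula.satAt_until_iff (φ ψ : Formula V Ch D K CV) (ρ : Computation V Ch D K CV) (i : ℕ) :
    (Formula.until φ ψ).SatAt ρ i ↔
      ψ.SatAt ρ i ∨ (φ.SatAt ρ i ∧ (Formula.until φ ψ).SatAt ρ (i + 1)) := by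
  constructor
  · rintro ⟨j, hij, hj, h⟩
    rcases hij.eq_or_lt with rfl | hij
    · exact .inl hj
    · exact .inr ⟨h i le_rfl hij, j, hij, hj, fun k hk => h k (by omega)⟩
  · rintro (h | ⟨h, j, hij, hj, h'⟩)
    · exact ⟨i, le_rfl, h, fun k _ _ => by omega⟩
    · refine ⟨j, by omega, hj, fun k hk hk' => ?_⟩
      rcases hk.eq_or_lt with rfl | hk
      · exact h
      · exact h' k hk hk'

theorem Formula.satAt_release_iff (φ ψ : Formula V Ch D K CV) (ρ : Computation V Ch D K CV)
    (i : ℕ) : (Formula.release φ ψ).SatAt ρ i ↔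
      ψ.SatAt ρ i ∧ (φ.SatAt ρ i ∨ (Formula.release φ ψ).SatAt ρ (i + 1)) := by
  constructor
  · intro h
    refine ⟨(h i le_rfl).resolve_right fun ⟨k, hk, hk', _⟩ => by omega, ?_⟩
    by_cases hφ : φ.SatAt ρ i
    · exact .inl hφ
    · refine .inr fun j hj => (h j (by omega)).imp id ?_
      rintro ⟨k, hk, hkj, hk'⟩
      rcases hk.eq_or_lt with rfl | hk
      · exact absurd hk' hφ
      · exact ⟨k, hk, hkj, hk'⟩
  · rintro ⟨h, h'⟩ j hj
    rcases hj.eq_or_lt with rfl | hj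
    · exact .inl h
    · rcases h' with h' | h'
      · exact .inr ⟨i, le_rfl, hj, h'⟩
      · refine (h' j hj).imp id ?_
        rintro ⟨k, hk, hkj, hk'⟩
        exact ⟨k, by omega, hkj, hk'⟩

/-- With first bits equal to truth, the local conditions are the unfolding laws of the operators.
The hypothesis `hd` has the form of the recursion of `sinceBreak`. -/
theorem Formula.step_of_label (φ : Formula V Ch D K CV) (ρ : Computation V Ch D K CV) (i : ℕ)
    (fin : Prop) (q q' : ℕ → Bool × Bool) (p : ℕ)
    (h : ∀ k < φ.size, (q (p + k)).1 = true ↔ φ.label (·.SatAt ρ i) False k)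
    (h' : ∀ k < φ.size, (q' (p + k)).1 = true ↔ φ.label (·.SatAt ρ (i + 1)) False k)
    (hd : ∀ k < φ.size, (q' (p + k)).2 = true →
      φ.label (·.Discharged ρ (i + 1)) True k ∨ ((q (p + k)).2 = true ∧ ¬ fin)) :
    φ.Step (ρ i) fin q q' p := by
  induction φ using Formula.structural generalizing p with
  | var v | nvar v => exact (h 0 (by simp [Formula.size, Formula.word])).1
  | or φ ψ ih₁ ih₂ | and φ ψ ih₁ ih₂ | strongUntil φ ψ ih₁ ih₂ | release φ ψ ih₁ ih₂ =>
    have hφ : 0 < φ.size := by cases φ <;> simp [Formula.size, Formula.word]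
    have hψ : 0 < ψ.size := by cases ψ <;> simp [Formula.size, Formula.word]
    rw [show Formula.size _ = 1 + φ.size + ψ.size by simp [Formula.size, Formula.word]; omega]
      at h h' hd
    have g₁ : ∀ k < φ.size, (q (p + 1 + k)).1 = true ↔ φ.label (·.SatAt ρ i) False k := by
      intro k hk
      simpa [Formula.label, hk, ← add_assoc] using h (1 + k) (by omega)
    have g₂ : ∀ k < ψ.size, (q (p + 1 + φ.size + k)).1 = true ↔
        ψ.label (·.SatAt ρ i) False k := by
      intro k hk
      simpa [Formula.label, add_assoc] using h (1 + (φ.size + k)) (by omega)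
    have g₁' : ∀ k < φ.size, (q' (p + 1 + k)).1 = true ↔
        φ.label (·.SatAt ρ (i + 1)) False k := by
      intro k hk
      simpa [Formula.label, hk, ← add_assoc] using h' (1 + k) (by omega)
    have g₂' : ∀ k < ψ.size, (q' (p + 1 + φ.size + k)).1 = true ↔
        ψ.label (·.SatAt ρ (i + 1)) False k := by
      intro k hk
      simpa [Formula.label, add_assoc] using h' (1 + (φ.size + k)) (by omega)
    have s₁ := ih₁ (p + 1) g₁ g₁' (by
      intro k hk
      simpa [Formula.label, hk, ← add_assoc] using hd (1 + k) (by omega))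
    have s₂ := ih₂ (p + 1 + φ.size) g₂ g₂' (by
      intro k hk
      simpa [Formula.label, add_assoc] using hd (1 + (φ.size + k)) (by omega))
    refine ⟨?_, s₁, s₂⟩
    have e := h 0 (by omega)
    have e' := h' 0 (by omega)
    have ed := hd 0 (by omega)
    have e₁ := g₁ 0 hφ
    have e₂ := g₂ 0 hψ
    have e₂' := g₂' 0 hψ
    simp only [Formula.label_zero, add_zero] at e e' e₁ e₂ e₂' ed
    simp only [e, e', e₁, e₂, e₂']
    first
    | exact id
    | exact (Formula.satAt_release_iff φ ψ ρ i).1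
    | exact ⟨(Formula.satAt_until_iff φ ψ ρ i).1, by simpa only [Formula.Discharged, e'] using ed⟩
  | possible O φ ih | necessary O φ ih =>
    have hφ : 0 < φ.size := by cases φ <;> simp [Formula.size, Formula.word]
    rw [show Formula.size _ = 1 + (O.word (V := V)).length + φ.size by
      simp [Formula.size, Formula.word]; omega] at h h' hd
    have g : ∀ k < φ.size, (q (p + 1 + (O.word (V := V)).length + k)).1 = true ↔
        φ.label (·.SatAt ρ i) False k := by
      intro k hk
      simpa [Formula.label, add_assoc] using h (1 + ((O.word (V := V)).length + k)) (by omega)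
    have g' : ∀ k < φ.size, (q' (p + 1 + (O.word (V := V)).length + k)).1 = true ↔
        φ.label (·.SatAt ρ (i + 1)) False k := by
      intro k hk
      simpa [Formula.label, add_assoc] using h' (1 + ((O.word (V := V)).length + k)) (by omega)
    have s := ih (p + 1 + (O.word (V := V)).length) g g' (by
      intro k hk
      simpa [Formula.label, add_assoc] using hd (1 + ((O.word (V := V)).length + k)) (by omega))
    refine ⟨?_, s⟩
    have e := h 0 (by omega)
    have e' := g' 0 hφ
    simp only [Formula.label_zero, add_zero] at e e'
    simp only [e, e']
    exact id

open Classical in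
/-- The accepting run of the automaton on a computation that satisfies `φ`. -/
noncomputable def Formula.canonicalRun (φ : Formula V Ch D K CV) (ρ : Computation V Ch D K CV)
    (i : ℕ) : List.Vector (Bool × Bool) φ.size :=
  List.Vector.ofFn fun p => (decide (φ.label (·.SatAt ρ i) False p),
    decide (sinceBreak φ.size (fun i => φ.label (·.Discharged ρ i) True) i p))

open Classical in
theorem Formula.entry_canonicalRun (φ : Formula V Ch D K CV) (ρ : Computation V Ch D K CV) (i : ℕ)
    {p : ℕ} (hp : p < φ.size) : entry (φ.canonicalRun ρ i).1 p =
      (decide (φ.label (·.SatAt ρ i) False p),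
        decide (sinceBreak φ.size (fun i => φ.label (·.Discharged ρ i) True) i p)) := by
  have hl : (φ.canonicalRun ρ i).1 = List.ofFn fun p : Fin φ.size =>
      (decide (φ.label (·.SatAt ρ i) False p),
        decide (sinceBreak φ.size (fun i => φ.label (·.Discharged ρ i) True) i p)) :=
    List.Vector.toList_ofFn _
  rw [entry, hl, List.getD_eq_getElem _ _ (by simpa using hp), List.getElem_ofFn]

theorem Formula.final_canonicalRun (φ : Formula V Ch D K CV) (ρ : Computation V Ch D K CV)
    (i : ℕ) : Final (φ.canonicalRun ρ i).1 ↔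
      ∀ k < φ.size, sinceBreak φ.size (fun i => φ.label (·.Discharged ρ i) True) i k := by
  unfold Final
  rw [(φ.canonicalRun ρ i).2]
  refine forall₂_congr fun p hp => ?_
  simp [φ.entry_canonicalRun ρ i hp]

theorem Formula.iUnion_wordLang_automaton (φ : Formula V Ch D K CV) :
    (⋃ w ∈ φ.automaton.lang, φ.wordLang w) = {ρ | φ.SatAt ρ 0} := by
  have hφ : 0 < φ.size := by cases φ <;> simp [Formula.size, Formula.word]
  ext ρ
  simp only [Set.mem_iUnion, exists_prop, Set.mem_ofPred_eq]
  constructor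
  · rintro ⟨w, ⟨r, hr, hδ, f, hf, hinf⟩, hw⟩
    refine φ.satAt_of_step ρ (fun i => entry (r i).1) (fun i => Final (r i).1)
      (hinf.mono fun i hi => by rw [hi]; exact hf) 0 (fun i hi k hk => ?_) (fun i => ?_) 0 hr
    · rw [zero_add]
      exact hi k (by rw [(r i).2]; exact hk)
    -- The observation `m` behind the transition need not be that of `ρ`, but both realize the same
    -- letter.
    · obtain ⟨m, hm, hs⟩ := hδ i
      rw [← (hw i).1] at hs
      refine (Formula.step_congr fun O hO => ?_).1 hs
      have := (hw i).2 ⟨O, hO⟩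
      rw [hm] at this
      exact this.symm
  · intro h
    -- Every computation satisfies the word made of its own states and of the descriptors that hold
    -- in it.
    refine ⟨fun i => ((ρ i).1, {O | O.1.Sat (ρ i).2}), ⟨φ.canonicalRun ρ, ?_, fun i => ?_, ?_⟩,
      fun i => ⟨rfl, fun O => Iff.rfl⟩⟩
    · change (entry _ 0).1 = true
      simpa [φ.entry_canonicalRun ρ 0 hφ, Formula.label_zero] using h
    · refine ⟨(ρ i).2, rfl, φ.step_of_label ρ i _ _ _ 0 ?_ ?_ ?_⟩
      · intro k hk
        simp [φ.entry_canonicalRun ρ i hk]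
      · intro k hk
        simp [φ.entry_canonicalRun ρ (i + 1) hk]
      · intro k hk
        rw [zero_add, φ.entry_canonicalRun ρ i hk, φ.entry_canonicalRun ρ (i + 1) hk,
          φ.final_canonicalRun]
        simp only [decide_eq_true_eq]
        exact id
    · have : Finite φ.automaton.Q := φ.automaton.finite_Q
      refine exists_frequently_eq ?_
      refine (frequently_sinceBreak (n := φ.size)
        (d := fun i => φ.label (·.Discharged ρ i) True) fun p i => ?_).mono fun i hi =>
          (φ.final_canonicalRun ρ i).2 hi
      rcases φ.label_cases p with ⟨χ, hχ⟩ | hd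
      · simpa only [hχ] using χ.exists_discharged ρ i
      · exact ⟨i, le_rfl, by rw [hd]; trivial⟩

/-! ### The size of the automaton -/

/-- Two bits per symbol. Symbols inside descriptors carry bits too, so that a state has exactly one
entry per input cell. -/
theorem Formula.numStates_automaton (φ : Formula V Ch D K CV) :
    φ.automaton.numStates = 2 ^ (2 * φ.size) := by
  change Nat.card (List.Vector (Bool × Bool) φ.size) = _
  rw [Nat.card_eq_fintype_card, card_vector, pow_mul]
  rfl

theorem Formula.length_descriptors_le (φ : Formula V Ch D K CV) :
    φ.descriptors.length ≤ φ.size := by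
  induction φ <;> simp_all [Formula.descriptors, Formula.size, Formula.word] <;> omega

instance (φ : Formula V Ch D K CV) : Finite φ.Obs := List.finite_toSet φ.descriptors

theorem Formula.card_set_obs_le (φ : Formula V Ch D K CV) :
    Nat.card (Set φ.Obs) ≤ 2 ^ φ.size := by
  classical
  have := Fintype.ofFinite φ.Obs
  rw [Nat.card_eq_fintype_card, Fintype.card_set]
  refine Nat.pow_le_pow_right (by norm_num) (le_trans ?_ φ.length_descriptors_le)
  rw [← Nat.card_eq_fintype_card]
  calc Nat.card φ.Obs ≤ Nat.card (Fin φ.descriptors.length) :=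
        Nat.card_le_card_of_surjective (fun i => ⟨φ.descriptors.get i, List.get_mem _ _⟩)
          fun ⟨O, hO⟩ => by
            obtain ⟨i, hi⟩ := List.get_of_mem hO
            exact ⟨i, Subtype.ext hi⟩
    _ = _ := by simp

theorem Formula.numTransitions_automaton_le [Finite V] (φ : Formula V Ch D K CV) :
    φ.automaton.numTransitions ≤
      φ.automaton.numStates ^ 2 * Nat.card (V → Bool) * Nat.card (Set φ.Obs) := by
  have := φ.automaton.finite_Q
  calc φ.automaton.numTransitions
      ≤ Nat.card (φ.automaton.Q × φ.Letter × φ.automaton.Q) :=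
        Nat.card_le_card_of_injective _ Subtype.val_injective
    _ = _ := by simp only [Nat.card_prod, NBW.numStates]; ring

end Semantics

/-! ## Canonical representatives -/

section Representatives
variable {α : Type}

/-- Elements that belong to the same sets of `D`. -/
def sameSetoid (D : Set (Set α)) : Setoid α where
  r a b := ∀ X ∈ D, a ∈ X ↔ b ∈ X
  iseqv := ⟨fun _ _ _ => Iff.rfl, fun h X hX => (h X hX).symm,
    fun h h' X hX => (h X hX).trans (h' X hX)⟩

/-- `a` is the representative of the elements that belong to the same sets of `D` as `a`. -/
def Canonical (D : Set (Set α)) (a : α) : Prop :=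
  (Quotient.mk (sameSetoid D) a).out = a

/-- Canonicity keeps exactly one observation per letter: with `exists_canonical` no realizable
letter is lost, and by this lemma none is repeated. -/
theorem Canonical.eq {D : Set (Set α)} {a b : α} (ha : Canonical D a) (hb : Canonical D b)
    (h : ∀ X ∈ D, a ∈ X ↔ b ∈ X) : a = b := by
  rw [← ha, ← hb]
  exact congrArg Quotient.out (Quotient.sound (s := sameSetoid D) h)

theorem exists_canonical (D : Set (Set α)) (a : α) :
    ∃ b, Canonical D b ∧ ∀ X ∈ D, b ∈ X ↔ a ∈ X := by
  refine ⟨(Quotient.mk (sameSetoid D) a).out, ?_, Quotient.mk_out (s := sameSetoid D) a⟩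
  unfold Canonical
  rw [Quotient.out_eq]

end Representatives

/-! ## The values of the up-sweep -/

section Values
variable {V Ch D K CV : Type}

instance [Finite Ch] [Finite D] [Finite K] [Finite CV] : Finite (Observation Ch D K CV) :=
  Finite.of_injective (fun m => (m.ch, m.data, m.sender, m.pred)) fun m m' h => by
    cases m
    cases m'
    simpa using h

variable (V Ch D K CV) in
/-- The value of a subformula or descriptor: the obligation bits of its root in the two states,
whether all entries of the first state have the second bit set, whether all entries of the second
state are zero, the semantics of a descriptor and of the descriptor argument, the semantics of the
top-level descriptors, and the local conditions. -/
structure Val : Type where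
  now : Prop
  next : Prop
  fin : Prop
  blank : Prop
  sem : Set (Observation Ch D K CV)
  arg : Set (Observation Ch D K CV)
  classes : Set (Set (Observation Ch D K CV))
  ok : (V → Bool) × Observation Ch D K CV → Prop → Prop

/-- The number of values is large but does not depend on any formula. This is what allows a value,
with its sets of observations, to be a single tape symbol. -/
instance [Finite V] [Finite Ch] [Finite D] [Finite K] [Finite CV] : Finite (Val V Ch D K CV) :=
  Finite.of_injective
    (fun r => (r.now, r.next, r.fin, r.blank, r.sem, r.arg, r.classes, r.ok)) fun r r' h => by
    cases r
    cases r'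
    simpa using h

/-- Digits: an entry of a state and an entry of another one. -/
abbrev Digit : Type := (Bool × Bool) × (Bool × Bool)

/-- The value that stands for a missing argument. -/
def Val.bot : Val V Ch D K CV where
  now := False
  next := False
  fin := True
  blank := True
  sem := ∅
  arg := ∅
  classes := ∅
  ok := fun _ _ => True

/-- The semantics of a descriptor from its first symbol and the semantics of its arguments. -/
def Token.sem : Token V Ch D K CV → Set (Observation Ch D K CV) → Set (Observation Ch D K CV) →
    Set (Observation Ch D K CV)
  | .cv x, _, _ => {m | (Descriptor.cv x).Sat m}
  | .ncv x, _, _ => {m | (Descriptor.ncv x).Sat m}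
  | .ch a, _, _ => {m | (Descriptor.ch a).Sat m}
  | .nch a, _, _ => {m | (Descriptor.nch a).Sat m}
  | .agent k, _, _ => {m | (Descriptor.agent k).Sat m}
  | .nagent k, _, _ => {m | (Descriptor.nagent k).Sat m}
  | .data d, _, _ => {m | (Descriptor.data d).Sat m}
  | .ndata d, _, _ => {m | (Descriptor.ndata d).Sat m}
  | .ex, A, _ => {m | ∃ c ∈ m.pred, { m with pred := {c} } ∈ A}
  | .all, A, _ => {m | ∀ c ∈ m.pred, { m with pred := {c} } ∈ A}
  | .descOr, A, B => A ∪ B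
  | .descAnd, A, B => A ∩ B
  | _, _, _ => ∅

/-- The semantics of the top-level descriptors. -/
def Token.classes : Token V Ch D K CV → Val V Ch D K CV → Val V Ch D K CV →
    Set (Set (Observation Ch D K CV))
  | .possible, r, s => insert r.sem s.classes
  | .necessary, r, s => insert r.sem s.classes
  | _, r, s => r.classes ∪ s.classes

/-- The local condition at a position. -/
def Token.ok : Token V Ch D K CV → Digit → Val V Ch D K CV → Val V Ch D K CV →
    (V → Bool) × Observation Ch D K CV → Prop → Prop
  | .var v, e, _, _, a, _ => e.1.1 = true → a.1 v = true
  | .nvar v, e, _, _, a, _ => e.1.1 = true → ¬ a.1 v = true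
  | .or, e, r, s, _, _ => e.1.1 = true → r.now ∨ s.now
  | .and, e, r, s, _, _ => e.1.1 = true → r.now ∧ s.now
  | .until, e, r, s, _, fin => (e.1.1 = true → s.now ∨ (r.now ∧ e.2.1 = true)) ∧
      (e.2.2 = true → (e.2.1 = true → s.next) ∨ (e.1.2 = true ∧ ¬ fin))
  | .release, e, r, s, _, _ => e.1.1 = true → s.now ∧ (r.now ∨ e.2.1 = true)
  | .possible, e, r, s, a, _ => e.1.1 = true → a.2 ∈ r.sem ∧ s.next
  | .necessary, e, r, s, a, _ => e.1.1 = true → a.2 ∈ r.sem → s.next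
  | _, _, _, _, _, _ => True

/-- The value of a term from its first symbol and the values of its arguments. -/
def Val.comb (i : Token V Ch D K CV) (e : Digit) (r s : Val V Ch D K CV) : Val V Ch D K CV where
  now := e.1.1 = true
  next := e.2.1 = true
  fin := e.1.2 = true ∧ r.fin ∧ s.fin
  blank := e.2 = (false, false) ∧ r.blank ∧ s.blank
  sem := i.sem r.sem s.sem
  arg := r.sem
  classes := i.classes r s
  ok := fun a fin => i.ok e r s a fin ∧ r.ok a fin ∧ s.ok a fin

/-- The number of arguments of a symbol. -/
def Token.arity : Token V Ch D K CV → Fin 3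
  | .ex => 1
  | .all => 1
  | .descOr => 2
  | .descAnd => 2
  | .or => 2
  | .and => 2
  | .until => 2
  | .release => 2
  | .possible => 2
  | .necessary => 2
  | _ => 0

/-- What is listed in a run through all words of digits: the states, or the transitions with given
state letter and observation. -/
abbrev Kind (V Ch D K CV : Type) : Type := Option ((V → Bool) × Observation Ch D K CV)

/-- Whether a word of digits, whose value is `r`, gives a record. -/
def Kind.Check : Kind V Ch D K CV → Val V Ch D K CV → Prop
  | none, r => r.blank
  -- Whether the first state is accepting is known only at the root; this is why `ok` takes it as a
  -- parameter, supplied here.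
  | some a, r => r.ok a r.fin ∧ Canonical r.classes a.2

open Classical in
/-- The beginning of the part `j` of a record. -/
noncomputable def Kind.header :
    Kind V Ch D K CV → Fin 3 → Val V Ch D K CV → List (OutSym V)
  | none, 0, r => [.state, .bit (decide r.now), .bit (decide r.fin)]
  | none, _, _ => []
  | some _, 0, _ => [.trans]
  | some a, 1, _ => [.letter a.1]
  | some _, 2, _ => [.arrow]

/-- The bits of an entry. -/
def bits (b : Bool × Bool) : List Bool := [b.1, b.2]

open Classical in
/-- The bit for an occurrence of a top-level descriptor. -/
noncomputable def Token.obsBit (m : Observation Ch D K CV) (r : Val V Ch D K CV) :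
    Token V Ch D K CV → List (OutSym V)
  | .possible => [.bit (decide (m ∈ r.arg))]
  | .necessary => [.bit (decide (m ∈ r.arg))]
  | _ => []

/-- The output at a position in the part `j` of a record. -/
noncomputable def Kind.body (κ : Kind V Ch D K CV) (j : Fin 3)
    (x : Token V Ch D K CV × Digit × Val V Ch D K CV) : List (OutSym V) :=
  if j = 0 then (bits x.2.1.1).map .bit
  else κ.elim [] fun a => if j = 1 then x.1.obsBit a.2 x.2.2 else (bits x.2.1.2).map .bit

/-- The new carry and the new digit in an increment. -/
def nextDigit {E : Type} (succ : E → Option E) (zero : E) : Bool → E → Bool × E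
  | false, e => (false, e)
  | true, e => ((succ e).isNone, (succ e).getD zero)

/-- Presents the increment as a left-to-right transducer whose only memory is the carry, so it can
be done during the output pass. -/
theorem increment_cons {E : Type} (succ : E → Option E) (zero : E) (c : Bool) (e : E)
    (es : List E) : increment succ zero c (e :: es) =
      ((increment succ zero (nextDigit succ zero c e).1 es).1,
        (nextDigit succ zero c e).2 :: (increment succ zero (nextDigit succ zero c e).1 es).2) := by
  cases c with
  | false => simp [nextDigit]
  | true => rw [increment]; cases h : succ e <;> simp [nextDigit, h]

/-! ### The sweeper that prints the automaton -/

section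
variable [Finite V] [Finite Ch] [Finite D] [Finite K] [Finite CV]

open Classical in
/-- The sweeper that writes the description of the automaton. For each kind and each word of digits
it makes three rounds, one for each part of the record. -/
noncomputable def sweeper (nextKind : Kind V Ch D K CV → Option (Kind V Ch D K CV))
    (succ : Digit → Option Digit) : Sweeper (Token V Ch D K CV) (OutSym V) where
  E := Digit
  R := Val V Ch D K CV
  C := Kind V Ch D K CV × Fin 3
  L := (Kind V Ch D K CV × Fin 3) × Bool × Bool
  finite_E := inferInstance
  finite_R := inferInstance
  finite_C := inferInstance
  finite_L := inferInstance
  zero := ((false, false), (false, false))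
  bot := Val.bot
  start := (none, 0)
  arity := Token.arity
  comb := Val.comb
  -- The carry is set initially only in part `2`. Parts `0` and `1` leave the digits unchanged, so
  -- all three parts of a record come from the same word.
  begin c r := ((c, decide (c.1.Check r), decide (c.2 = 2)),
    if c.1.Check r then c.1.header c.2 r else [])
  move l i e r := ((l.1, l.2.1, (nextDigit succ ((false, false), (false, false)) l.2.2 e).1),
    (nextDigit succ ((false, false), (false, false)) l.2.2 e).2,
    if l.2.1 = true then l.1.1.body l.1.2 (i, e, r) else [])
  finish l :=
    if l.1.2 = 0 then some (l.1.1, 1)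
    else if l.1.2 = 1 then some (l.1.1, 2)
    -- A carry left over at the end of the pass means that all words have been used for this kind.
    else if l.2.2 = true then (nextKind l.1.1).map (·, 0)
    else some (l.1.1, 0)

variable {nextKind : Kind V Ch D K CV → Option (Kind V Ch D K CV)}
  {succ : Digit → Option Digit}

/-- The zero digit. -/
abbrev zeroDigit : Digit := ((false, false), (false, false))

theorem sweeper_pass (c : Kind V Ch D K CV × Fin 3) (pr cy : Bool)
    (y : List (Token V Ch D K CV × Digit × Val V Ch D K CV)) (w : List (Token V Ch D K CV))
    (es : List Digit) (hl : w.length = es.length)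
    (hy : y.map (fun x => (x.1, x.2.1)) = w.zip es) :
    (sweeper nextKind succ).pass (c, pr, cy) y =
      ((c, pr, (increment succ zeroDigit cy es).1), w.zip (increment succ zeroDigit cy es).2,
        if pr = true then y.flatMap (c.1.body c.2) else []) := by
  induction y generalizing w es cy with
  | nil =>
    have : w = [] := by
      have := congrArg List.length hy
      simp only [List.map_nil, List.length_nil, List.length_zip] at this
      exact List.eq_nil_of_length_eq_zero (by omega)
    subst this
    obtain rfl : es = [] := List.eq_nil_of_length_eq_zero (by simpa using hl.symm)
    cases pr <;> rfl
  | cons x y ih =>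
    obtain ⟨i, e, r⟩ := x
    cases w with
    | nil => simp at hy
    | cons t w =>
      cases es with
      | nil => simp at hl
      | cons e' es =>
        simp only [List.map_cons, List.zip_cons_cons, List.cons.injEq, Prod.mk.injEq] at hy
        obtain ⟨⟨rfl, rfl⟩, hy⟩ := hy
        have := ih (nextDigit succ zeroDigit cy e).1 w es (by simpa using hl) hy
        rw [increment_cons]
        change (((sweeper nextKind succ).pass (c, pr, (nextDigit succ zeroDigit cy e).1) y).1,
          (i, (nextDigit succ zeroDigit cy e).2) ::
            ((sweeper nextKind succ).pass (c, pr, (nextDigit succ zeroDigit cy e).1) y).2.1,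
          (if pr = true then c.1.body c.2 (i, e, r) else []) ++
            ((sweeper nextKind succ).pass (c, pr, (nextDigit succ zeroDigit cy e).1) y).2.2) = _
        rw [this]
        cases pr <;> simp <;> rfl

open Classical in
/-- The record written in three rounds. -/
noncomputable def Kind.record (κ : Kind V Ch D K CV)
    (y : List (Token V Ch D K CV × Digit × Val V Ch D K CV)) (r : Val V Ch D K CV) :
    List (OutSym V) :=
  if κ.Check r then
    (κ.header 0 r ++ y.flatMap (κ.body 0)) ++ ((κ.header 1 r ++ y.flatMap (κ.body 1)) ++
      (κ.header 2 r ++ y.flatMap (κ.body 2)))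
  else []

open Classical in
theorem sweeper_round_more {κ : Kind V Ch D K CV} {j : Fin 3} {w : List (Token V Ch D K CV)}
    {es : List Digit} (hl : w.length = es.length)
    {y : List (Token V Ch D K CV × Digit × Val V Ch D K CV)}
    (hy : y.map (fun x => (x.1, x.2.1)) = w.zip es) {r : Val V Ch D K CV}
    (h : (sweeper nextKind succ).Eval (w.zip es) y [r, Val.bot])
    {c' : Kind V Ch D K CV × Fin 3}
    (hf : (sweeper nextKind succ).finish ((κ, j), decide (κ.Check r),
      (increment succ zeroDigit (decide (j = 2)) es).1) = some c') {out : List (OutSym V)}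
    (hout : (sweeper nextKind succ).Rounds c'
      (w.zip (increment succ zeroDigit (decide (j = 2)) es).2) out) :
    (sweeper nextKind succ).Rounds (κ, j) (w.zip es)
      ((if κ.Check r then κ.header j r ++ y.flatMap (κ.body j) else []) ++ out) := by
  have hp := sweeper_pass (nextKind := nextKind) (succ := succ) (κ, j) (decide (κ.Check r))
    (decide (j = 2)) y w es hl hy
  have := Sweeper.Rounds.more (P := sweeper nextKind succ) (c := (κ, j)) (c' := c') (out := out) h
  change (sweeper nextKind succ).finish ((sweeper nextKind succ).pass ((κ, j), decide (κ.Check r),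
    decide (j = 2)) y).1 = some c' → (sweeper nextKind succ).Rounds c'
    ((sweeper nextKind succ).pass ((κ, j), decide (κ.Check r), decide (j = 2)) y).2.1 out →
    (sweeper nextKind succ).Rounds (κ, j) (w.zip es) ((if κ.Check r then κ.header j r else []) ++
      ((sweeper nextKind succ).pass ((κ, j), decide (κ.Check r), decide (j = 2)) y).2.2 ++ out)
    at this
  rw [hp] at this
  convert this hf hout using 2
  by_cases hc : κ.Check r <;> simp [hc]

open Classical in
theorem sweeper_round_last {κ : Kind V Ch D K CV} {w : List (Token V Ch D K CV)}
    {es : List Digit} (hl : w.length = es.length)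
    {y : List (Token V Ch D K CV × Digit × Val V Ch D K CV)}
    (hy : y.map (fun x => (x.1, x.2.1)) = w.zip es) {r : Val V Ch D K CV}
    (h : (sweeper nextKind succ).Eval (w.zip es) y [r, Val.bot])
    (hs : succWord succ zeroDigit es = none) (hκ : nextKind κ = none) :
    (sweeper nextKind succ).Rounds (κ, 2) (w.zip es)
      (if κ.Check r then κ.header 2 r ++ y.flatMap (κ.body 2) else []) := by
  have hp := sweeper_pass (nextKind := nextKind) (succ := succ) (κ, 2) (decide (κ.Check r))
    true y w es hl hy
  have := Sweeper.Rounds.last (P := sweeper nextKind succ) (c := (κ, 2)) h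
  change (sweeper nextKind succ).finish ((sweeper nextKind succ).pass ((κ, 2), decide (κ.Check r),
    true) y).1 = none →
    (sweeper nextKind succ).Rounds (κ, 2) (w.zip es) ((if κ.Check r then κ.header 2 r else []) ++
      ((sweeper nextKind succ).pass ((κ, 2), decide (κ.Check r), true) y).2.2) at this
  rw [hp] at this
  have hi : (increment succ zeroDigit true es).1 = true := by
    by_contra hi
    simp [succWord, hi] at hs
  convert this (by simp [sweeper, hi, hκ]) using 1
  by_cases hc : κ.Check r <;> simp [hc]

/-- What the sweeper writes after it has gone through all words of digits for `κ`. -/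
def Continues (nextKind : Kind V Ch D K CV → Option (Kind V Ch D K CV))
    (succ : Digit → Option Digit) (w : List (Token V Ch D K CV)) (κ : Kind V Ch D K CV)
    (out : List (OutSym V)) : Prop :=
  (nextKind κ = none ∧ out = []) ∨ ∃ κ', nextKind κ = some κ' ∧
    (sweeper nextKind succ).Rounds (κ', 0) (w.zip (List.replicate w.length zeroDigit)) out

/-- `Rounds` is built from its end, so the three rounds are prepended in the order `2`, `1`, `0` to
what follows the record. -/
theorem rounds_record {κ : Kind V Ch D K CV} {w : List (Token V Ch D K CV)}
    {es : List Digit} (hl : w.length = es.length)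
    {y : List (Token V Ch D K CV × Digit × Val V Ch D K CV)}
    (hy : y.map (fun x => (x.1, x.2.1)) = w.zip es) {r : Val V Ch D K CV}
    (h : (sweeper nextKind succ).Eval (w.zip es) y [r, Val.bot]) {out : List (OutSym V)}
    (hout : (succWord succ zeroDigit es = none ∧ Continues nextKind succ w κ out) ∨
      ∃ es', succWord succ zeroDigit es = some es' ∧
        (sweeper nextKind succ).Rounds (κ, 0) (w.zip es') out) :
    (sweeper nextKind succ).Rounds (κ, 0) (w.zip es) (κ.record y r ++ out) := by
  classical
  have key : (sweeper nextKind succ).Rounds (κ, 2) (w.zip es)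
      ((if κ.Check r then κ.header 2 r ++ y.flatMap (κ.body 2) else []) ++ out) := by
    rcases hout with ⟨hs, ⟨hκ, rfl⟩ | ⟨κ', hκ, hout⟩⟩ | ⟨es', hs, hout⟩
    · simpa using sweeper_round_last hl hy h hs hκ
    · have hi : (increment succ zeroDigit true es).1 = true := by
        by_contra hi
        simp [succWord, hi] at hs
      refine sweeper_round_more hl hy h (c' := (κ', 0)) (by simp [sweeper, hi, hκ]) ?_
      -- After the overflow the digits are all zero again, as the next kind expects.
      rw [show decide ((2 : Fin 3) = 2) = true from rfl, increment_of_overflow _ _ _ hi, ← hl]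
      exact hout
    · unfold succWord at hs
      split_ifs at hs with hi
      refine sweeper_round_more hl hy h (c' := (κ, 0)) (by simp [sweeper, hi]) ?_
      rw [show decide ((2 : Fin 3) = 2) = true from rfl, Option.some.inj hs]
      exact hout
  have h1 := sweeper_round_more (κ := κ) (j := 1) (c' := (κ, 2)) hl hy h (by simp [sweeper])
    (by simpa using key)
  have h0 := sweeper_round_more (κ := κ) (j := 0) (c' := (κ, 1)) hl hy h (by simp [sweeper])
    (by simpa using h1)
  convert h0 using 1
  unfold Kind.record
  by_cases hc : κ.Check r <;> simp [hc]

/-- The hypothesis `ht` separates the loop from the evaluation: the loop only has to know which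
record each word of digits yields. `rounds_kinds` adds the outer loop over the kinds. -/
theorem rounds_words {κ : Kind V Ch D K CV} {w : List (Token V Ch D K CV)}
    {target : List Digit → List (OutSym V)}
    (ht : ∀ es : List Digit, es.length = w.length → ∃ y r,
      y.map (fun x => (x.1, x.2.1)) = w.zip es ∧
      (sweeper nextKind succ).Eval (w.zip es) y [r, Val.bot] ∧ κ.record y r = target es)
    {es : List Digit} {ws : List (List Digit)} (hws : Enumerates (succWord succ zeroDigit) es ws)
    (hl : es.length = w.length) {out : List (OutSym V)} (hout : Continues nextKind succ w κ out) :
    (sweeper nextKind succ).Rounds (κ, 0) (w.zip es) (ws.flatMap target ++ out) := by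
  induction hws with
  | @last es h =>
    obtain ⟨y, r, hy, he, hr⟩ := ht es hl
    simpa [hr] using rounds_record hl.symm hy he (.inl ⟨h, hout⟩)
  | @cons es es' ws h _ ih =>
    obtain ⟨y, r, hy, he, hr⟩ := ht es hl
    have hl' : es'.length = w.length := by
      unfold succWord at h
      split_ifs at h
      rw [← Option.some.inj h, length_increment, hl]
    simpa [hr] using rounds_record hl.symm hy he (.inr ⟨es', h, ih hl'⟩)

theorem rounds_kinds {w : List (Token V Ch D K CV)}
    {target : Kind V Ch D K CV → List Digit → List (OutSym V)}
    (ht : ∀ κ, ∀ es : List Digit, es.length = w.length → ∃ y r,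
      y.map (fun x => (x.1, x.2.1)) = w.zip es ∧
      (sweeper nextKind succ).Eval (w.zip es) y [r, Val.bot] ∧ κ.record y r = target κ es)
    {ws : List (List Digit)}
    (hws : Enumerates (succWord succ zeroDigit) (List.replicate w.length zeroDigit) ws)
    {κ : Kind V Ch D K CV} {κs : List (Kind V Ch D K CV)} (hκ : Enumerates nextKind κ κs) :
    (sweeper nextKind succ).Rounds (κ, 0) (w.zip (List.replicate w.length zeroDigit))
      (κs.flatMap fun κ => ws.flatMap (target κ)) := by
  induction hκ with
  | @last κ h =>
    have := rounds_words (ht κ) hws (by simp) (.inl ⟨h, rfl⟩)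
    rw [List.append_nil] at this
    rwa [List.flatMap_singleton]
  | @cons κ κ' κs h _ ih =>
    rw [List.flatMap_cons]
    exact rounds_words (ht κ) hws (by simp) (.inr ⟨κ', h, ih⟩)

end

end Values

/-! ## Evaluation of formulas -/

section Evaluation

theorem Sweeper.Eval.of_eq {I X : Type} {P : Sweeper I X} {u u' y y' s} (h : P.Eval u y s)
    (hu : u = u') (hy : y = y') : P.Eval u' y' s := by
  subst hu hy
  exact h

/-- The term `u` has the value `r`, and the evaluation attaches values as in `y`. -/
def Sweeper.Parses {I X : Type} (P : Sweeper I X) (u : List (I × P.E)) (y : List (I × P.E × P.R))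
    (r : P.R) : Prop :=
  ∀ u' y' s, P.Eval u' y' s → P.Eval (u ++ u') (y ++ y') (r :: s)

/-- The word `w` with the digits given by `g`, from position `p` on. -/
def cells {I : Type} (g : ℕ → Digit) : List I → ℕ → List (I × Digit)
  | [], _ => []
  | i :: w, p => (i, g p) :: cells g w (p + 1)

theorem cells_append {I : Type} (g : ℕ → Digit) (w w' : List I) (p : ℕ) :
    cells g (w ++ w') p = cells g w p ++ cells g w' (p + w.length) := by
  induction w generalizing p with
  | nil => rfl
  | cons i w ih => simp [cells, ih, add_assoc, add_comm 1]

theorem cells_congr {I : Type} {g g' : ℕ → Digit} (w : List I) {p p' : ℕ}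
    (h : ∀ k, g (p + k) = g' (p' + k)) : cells g w p = cells g' w p' := by
  induction w generalizing p p' with
  | nil => rfl
  | cons i w ih =>
    rw [cells, cells, show g p = g' p' from h 0, ih]
    intro k
    rw [add_assoc, add_assoc]
    exact h (1 + k)

theorem cells_getD {I : Type} (d : Digit) (w : List I) (es : List Digit)
    (h : w.length = es.length) : cells (es.getD · d) w 0 = w.zip es := by
  induction w generalizing es with
  | nil => simp [cells]
  | cons i w ih =>
    cases es with
    | nil => simp at h
    | cons e es =>
      rw [cells, List.zip_cons_cons, ← ih es (by simpa using h),
        cells_congr w (g' := (es.getD · d)) (p' := 0) (fun k => ?_)]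
      · simp
      · rw [zero_add, zero_add, add_comm, List.getD_cons_succ]

variable {V Ch D K CV : Type} [Finite V] [Finite Ch] [Finite D] [Finite K] [Finite CV]
  {nextKind : Kind V Ch D K CV → Option (Kind V Ch D K CV)} {succ : Digit → Option Digit}

variable (nextKind succ) in
/-- What the evaluation of a word computes, whether a descriptor or a formula is written in it. -/
structure Evaluates (g : ℕ → Digit) (w : List (Token V Ch D K CV)) (p : ℕ)
    (y : List (Token V Ch D K CV × Digit × Val V Ch D K CV)) (r : Val V Ch D K CV) : Prop where
  parses : (sweeper nextKind succ).Parses (cells g w p) y r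
  forget : y.map (fun x => (x.1, x.2.1)) = cells g w p
  now : r.now ↔ (g p).1.1 = true
  next : r.next ↔ (g p).2.1 = true
  fin : r.fin ↔ ∀ x ∈ cells g w p, x.2.1.2 = true
  blank : r.blank ↔ ∀ x ∈ cells g w p, x.2.2 = (false, false)

theorem Evaluates.leaf (g : ℕ → Digit) {i : Token V Ch D K CV} (hi : i.arity = 0) (p : ℕ) :
    Evaluates nextKind succ g [i] p [(i, g p, .comb i (g p) .bot .bot)]
      (.comb i (g p) .bot .bot) where
  parses := fun _ _ _ h => .leaf (P := sweeper nextKind succ) i (g p) hi h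
  forget := rfl
  now := Iff.rfl
  next := Iff.rfl
  fin := by simp [Val.comb, Val.bot, cells]
  blank := by simp [Val.comb, Val.bot, cells]

theorem Evaluates.unary {g : ℕ → Digit} {i : Token V Ch D K CV} (hi : i.arity = 1) {p : ℕ}
    {w y r} (h : Evaluates nextKind succ g w (p + 1) y r) :
    Evaluates nextKind succ g (i :: w) p ((i, g p, .comb i (g p) r .bot) :: y)
      (.comb i (g p) r .bot) where
  parses := fun u y s h' => .unary (P := sweeper nextKind succ) i (g p) hi (h.parses u y s h')
  forget := by simp [cells, h.forget]
  now := Iff.rfl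
  next := Iff.rfl
  fin := by simp [Val.comb, Val.bot, cells, h.fin]
  blank := by simp [Val.comb, Val.bot, cells, h.blank]

theorem Evaluates.binary {g : ℕ → Digit} {i : Token V Ch D K CV} (hi : i.arity = 2) {p : ℕ}
    {w y₁ r w' y₂ r'} (h : Evaluates nextKind succ g w (p + 1) y₁ r)
    (h' : Evaluates nextKind succ g w' (p + 1 + w.length) y₂ r') :
    Evaluates nextKind succ g (i :: (w ++ w')) p ((i, g p, .comb i (g p) r r') :: (y₁ ++ y₂))
      (.comb i (g p) r r') where
  parses := fun (u : List (Token V Ch D K CV × Digit))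
      (y : List (Token V Ch D K CV × Digit × Val V Ch D K CV)) s hu => by
    rw [cells, cells_append]
    -- The right argument is evaluated first, so its value lies below that of the left one on the
    -- stack.
    have h₁ := h.parses _ _ _ (h'.parses u y s hu)
    have h₂ : (sweeper nextKind succ).Eval
        ((cells g w (p + 1) ++ cells g w' (p + 1 + w.length)) ++ u) ((y₁ ++ y₂) ++ y)
        (r :: r' :: s) := by
      exact h₁.of_eq (List.append_assoc _ _ _).symm (List.append_assoc _ _ _).symm
    exact .binary (P := sweeper nextKind succ) i (g p) hi h₂
  forget := by simp [cells, cells_append, h.forget, h'.forget]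
  now := Iff.rfl
  next := Iff.rfl
  fin := by simp [Val.comb, cells, cells_append, h.fin, h'.fin, or_imp, forall_and]
  blank := by simp [Val.comb, cells, cells_append, h.blank, h'.blank, or_imp, forall_and]

/-- Inside a descriptor only the semantics matters: its symbols impose no local condition, add no
top-level descriptor and print no descriptor bit. -/
theorem Descriptor.exists_evaluates (O : Descriptor Ch D K CV) (g : ℕ → Digit) (p : ℕ) :
    ∃ y r, Evaluates nextKind succ g (O.word (V := V)) p y r ∧ r.sem = {m | O.Sat m} ∧
      r.classes = ∅ ∧ (∀ a fin, r.ok a fin) ∧ ∀ m, y.flatMap (fun x => x.1.obsBit m x.2.2) = [] := by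
  induction O generalizing p with
  | cv | ncv | ch | nch | agent | nagent | data | ndata =>
    exact ⟨_, _, .leaf g rfl p, rfl, by simp [Val.comb, Token.classes, Val.bot],
      by simp [Val.comb, Token.ok, Val.bot], by simp [Token.obsBit]⟩
  | ex O ih | all O ih =>
    obtain ⟨y, r, he, hs, hc, hk, hb⟩ := ih (p + 1)
    exact ⟨_, _, he.unary rfl, by simp [Val.comb, Token.sem, hs, Descriptor.Sat],
      by simp [Val.comb, Token.classes, Val.bot, hc], by simp [Val.comb, Token.ok, Val.bot, hk],
      fun m => by rw [List.flatMap_cons, hb]; rfl⟩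
  | or O₁ O₂ ih₁ ih₂ | and O₁ O₂ ih₁ ih₂ =>
    obtain ⟨y, r, he, hs, hc, hk, hb⟩ := ih₁ (p + 1)
    obtain ⟨y', r', he', hs', hc', hk', hb'⟩ := ih₂ (p + 1 + (O₁.word (V := V)).length)
    exact ⟨_, _, he.binary rfl he', by
        simp only [Val.comb, Token.sem, hs, hs', Descriptor.Sat]; rfl,
      by simp [Val.comb, Token.classes, hc, hc'], by simp [Val.comb, Token.ok, hk, hk'],
      fun m => by rw [List.flatMap_cons, List.flatMap_append, hb, hb']; rfl⟩

open Classical in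
-- The link between program and automaton: the conditions collected at the root are the transition
-- relation, and the bits printed at the modal operators follow the order of `descriptors`.
-- Positions are absolute, as in `Formula.Step`.
theorem Formula.exists_evaluates (φ : Formula V Ch D K CV) (g : ℕ → Digit) (p : ℕ) :
    ∃ y r, Evaluates nextKind succ g φ.word p y r ∧
      r.classes = {X | ∃ O ∈ φ.descriptors, X = {m | O.Sat m}} ∧
      (∀ a fin, r.ok a fin ↔ φ.Step a fin (fun k => (g k).1) (fun k => (g k).2) p) ∧
      ∀ m, y.flatMap (fun x => x.1.obsBit m x.2.2) =
        φ.descriptors.map fun O => .bit (decide (O.Sat m)) := by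
  induction φ using Formula.structural generalizing p with
  | var | nvar =>
    exact ⟨_, _, .leaf g rfl p, by simp [Val.comb, Token.classes, Val.bot, Formula.descriptors],
      by simp [Val.comb, Token.ok, Val.bot, Formula.Step],
      by simp [Token.obsBit, Formula.descriptors]⟩
  | or φ ψ ih₁ ih₂ | and φ ψ ih₁ ih₂ | strongUntil φ ψ ih₁ ih₂ | release φ ψ ih₁ ih₂ =>
    obtain ⟨y, r, he, hc, hk, hb⟩ := ih₁ (p + 1)
    obtain ⟨y', r', he', hc', hk', hb'⟩ := ih₂ (p + 1 + φ.word.length)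
    refine ⟨_, _, he.binary rfl he', ?_, fun a fin => ?_, ?_⟩
    · simp only [Val.comb, Token.classes, hc, hc', Formula.descriptors, List.mem_append]
      ext X
      simp [or_and_right, exists_or]
    · simp only [Val.comb, Token.ok, hk, hk', Formula.Step, he.now, he'.now, he'.next]
      rfl
    · intro m
      rw [List.flatMap_cons, List.flatMap_append, hb, hb', Formula.descriptors, List.map_append]
      rfl
  | possible O φ ih | necessary O φ ih =>
    obtain ⟨y, r, he, hs, hc, hk, hb⟩ :=
      O.exists_evaluates (V := V) (nextKind := nextKind) (succ := succ) g (p + 1)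
    obtain ⟨y', r', he', hc', hk', hb'⟩ := ih (p + 1 + (O.word (V := V)).length)
    refine ⟨_, _, he.binary rfl he', ?_, fun a fin => ?_, ?_⟩
    · simp only [Val.comb, Token.classes, hs, hc', Formula.descriptors, List.mem_cons]
      ext X
      simp
    · simp only [Val.comb, Token.ok, hk, hk', Formula.Step, he'.next, hs, true_and]
      rfl
    · intro m
      rw [List.flatMap_cons, List.flatMap_append, hb, hb', Formula.descriptors, List.map_cons]
      simp [Token.obsBit, Val.comb, hs]

end Evaluation

/-! ## The description of the automaton -/

section Description
variable {V Ch D K CV : Type}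

/-- The top-level descriptors that an observation satisfies. -/
def Formula.obsSet (φ : Formula V Ch D K CV) (m : Observation Ch D K CV) : Set φ.Obs :=
  {O | O.1.Sat m}

/-- The name of a state. -/
def stateName (l : List (Bool × Bool)) : List Bool := l.flatMap bits

theorem stateName_injective : Function.Injective stateName := by
  intro l l' h
  induction l generalizing l' with
  | nil =>
    cases l' with
    | nil => rfl
    | cons b l' => simp [stateName, bits] at h
  | cons a l ih =>
    cases l' with
    | nil => simp [stateName, bits] at h
    | cons b l' =>
      simp only [stateName, bits, List.flatMap_cons, List.cons_append, List.nil_append,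
        List.cons.injEq] at h
      rw [Prod.ext h.1 h.2.1, ih h.2.2]

/-- The semantics of the top-level descriptors. -/
def Formula.classes (φ : Formula V Ch D K CV) : Set (Set (Observation Ch D K CV)) :=
  {X | ∃ O ∈ φ.descriptors, X = {m | O.Sat m}}

theorem Formula.obsSet_eq_iff (φ : Formula V Ch D K CV) (m m' : Observation Ch D K CV) :
    φ.obsSet m = φ.obsSet m' ↔ ∀ X ∈ φ.classes, m ∈ X ↔ m' ∈ X := by
  constructor
  · rintro h _ ⟨O, hO, rfl⟩
    exact Set.ext_iff.1 h ⟨O, hO⟩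
  · intro h
    ext O
    exact h _ ⟨O.1, O.2, rfl⟩

/-- The first state in a word of digits. -/
def firstState {n : ℕ} (es : List Digit) (h : es.length = n) : List.Vector (Bool × Bool) n :=
  ⟨es.map Prod.fst, by simpa using h⟩

/-- The second state in a word of digits. -/
def secondState {n : ℕ} (es : List Digit) (h : es.length = n) : List.Vector (Bool × Bool) n :=
  ⟨es.map Prod.snd, by simpa using h⟩

open Classical in
/-- The state given by a word of digits, if the second component is zero. -/
noncomputable def stateOf (n : ℕ) (es : List Digit) : Option (List.Vector (Bool × Bool) n) :=
  if h : es.length = n ∧ ∀ e ∈ es, e.2 = (false, false) then some (firstState es h.1) else none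

open Classical in
/-- The transition given by a word of digits and a letter, if there is one and if the letter is
written with the canonical observation. -/
noncomputable def Formula.transOf (φ : Formula V Ch D K CV)
    (a : (V → Bool) × Observation Ch D K CV) (es : List Digit) :
    Option (φ.automaton.Q × φ.Letter × φ.automaton.Q) :=
  if h : es.length = φ.size ∧ φ.Step a (Final (es.map Prod.fst)) (entry (es.map Prod.fst))
      (entry (es.map Prod.snd)) 0 ∧ Canonical φ.classes a.2 then
    some (firstState es h.1, (a.1, φ.obsSet a.2), secondState es h.1)
  else none

theorem eq_of_map_fst_snd {es es' : List Digit} (h₁ : es.map Prod.fst = es'.map Prod.fst)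
    (h₂ : es.map Prod.snd = es'.map Prod.snd) : es = es' := by
  rw [← List.zip_unzip es, ← List.zip_unzip es', List.unzip_eq_map, List.unzip_eq_map]
  simp only [h₁, h₂]

theorem nodup_filterMap_stateOf {n : ℕ} {ws : List (List Digit)} (h : ws.Nodup) :
    (ws.filterMap (stateOf n)).Nodup := by
  refine h.filterMap fun es es' q hq hq' => ?_
  simp only [stateOf, Option.mem_def, Option.dite_none_right_eq_some, Option.some.injEq] at hq hq'
  obtain ⟨h₁, rfl⟩ := hq
  obtain ⟨h₂, h₃⟩ := hq'
  refine eq_of_map_fst_snd (congrArg Subtype.val h₃).symm ?_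
  rw [List.map_congr_left h₁.2, List.map_congr_left h₂.2, List.map_const', List.map_const', h₁.1,
    h₂.1]

theorem mem_filterMap_stateOf {n : ℕ} {ws : List (List Digit)} (h : ∀ es, es ∈ ws ↔ es.length = n)
    (q : List.Vector (Bool × Bool) n) : q ∈ ws.filterMap (stateOf n) := by
  rw [List.mem_filterMap]
  have hl : (q.1.map fun b => ((b, (false, false)) : Digit)).length = n := by simp [q.2]
  refine ⟨_, (h _).2 hl, ?_⟩
  rw [stateOf, dif_pos ⟨hl, by simp⟩]
  refine congrArg some (Subtype.ext ?_)
  simp [firstState, Function.comp_def]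

theorem Formula.transOf_eq_some {φ : Formula V Ch D K CV}
    {a : (V → Bool) × Observation Ch D K CV} {es : List Digit}
    {t : φ.automaton.Q × φ.Letter × φ.automaton.Q} : φ.transOf a es = some t ↔
      (es.length = φ.size ∧ φ.Step a (Final (es.map Prod.fst)) (entry (es.map Prod.fst))
        (entry (es.map Prod.snd)) 0 ∧ Canonical φ.classes a.2) ∧
      t.1.1 = es.map Prod.fst ∧ t.2.1 = (a.1, φ.obsSet a.2) ∧ t.2.2.1 = es.map Prod.snd := by
  unfold transOf
  split_ifs with h
  · rw [Option.some.injEq]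
    constructor
    · rintro rfl
      exact ⟨h, rfl, rfl, rfl⟩
    · rintro ⟨_, h₁, h₂, h₃⟩
      exact Prod.ext (Subtype.ext h₁.symm) (Prod.ext h₂.symm (Subtype.ext h₃.symm))
  · simp [h]

/-- The two states determine the word of digits, and the letter determines its canonical
observation, so no transition arises twice. -/
theorem Formula.nodup_transOf (φ : Formula V Ch D K CV) {ws : List (List Digit)} (h : ws.Nodup)
    {as : List ((V → Bool) × Observation Ch D K CV)} (ha : as.Nodup) :
    (as.flatMap fun a => ws.filterMap (φ.transOf a)).Nodup := by
  rw [List.nodup_flatMap]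
  refine ⟨fun a _ => h.filterMap fun es es' t ht ht' => ?_, ha.imp fun {a b} hab => ?_⟩
  · obtain ⟨_, h₁, _, h₂⟩ := transOf_eq_some.1 ht
    obtain ⟨_, h₁', _, h₂'⟩ := transOf_eq_some.1 ht'
    exact eq_of_map_fst_snd (h₁.symm.trans h₁') (h₂.symm.trans h₂')
  · simp only [Function.onFun]
    intro t ht ht'
    obtain ⟨es, _, ht⟩ := List.mem_filterMap.1 ht
    obtain ⟨es', _, ht'⟩ := List.mem_filterMap.1 ht'
    obtain ⟨⟨_, _, hc⟩, _, h₁, _⟩ := transOf_eq_some.1 ht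
    obtain ⟨⟨_, _, hc'⟩, _, h₁', _⟩ := transOf_eq_some.1 ht'
    have := Prod.ext_iff.1 (h₁.symm.trans h₁')
    exact hab (Prod.ext this.1 (hc.eq hc' ((φ.obsSet_eq_iff _ _).1 this.2)))

theorem Formula.mem_transOf (φ : Formula V Ch D K CV) {ws : List (List Digit)}
    (h : ∀ es, es ∈ ws ↔ es.length = φ.size) {as : List ((V → Bool) × Observation Ch D K CV)}
    (ha : ∀ a, a ∈ as) (t : φ.automaton.Q × φ.Letter × φ.automaton.Q) :
    t ∈ (as.flatMap fun a => ws.filterMap (φ.transOf a)) ↔ t ∈ φ.automaton.transitions := by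
  obtain ⟨q, ⟨σ, o⟩, q'⟩ := t
  constructor
  · intro ht
    obtain ⟨a, _, ht⟩ := List.mem_flatMap.1 ht
    obtain ⟨es, _, ht⟩ := List.mem_filterMap.1 ht
    obtain ⟨⟨_, hs, _⟩, h₁, h₂, h₃⟩ := transOf_eq_some.1 ht
    obtain ⟨rfl, rfl⟩ := Prod.ext_iff.1 h₂
    refine ⟨a.2, rfl, ?_⟩
    rw [← h₁, ← h₃] at hs
    exact hs
  · rintro ⟨m, hm, hs⟩
    -- The transition is printed with the representative of `m`, which has the same letter and
    -- admits the same steps.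
    obtain ⟨m', hc, hm'⟩ := exists_canonical φ.classes m
    have hq : q.1.length = φ.size := q.2
    have hq' : q'.1.length = φ.size := q'.2
    have h₁ : (q.1.zip q'.1).map Prod.fst = q.1 := List.map_fst_zip (by omega)
    have h₂ : (q.1.zip q'.1).map Prod.snd = q'.1 := List.map_snd_zip (by omega)
    have hl : (q.1.zip q'.1).length = φ.size := by simp [hq, hq']
    refine List.mem_flatMap.2 ⟨(σ, m'), ha _, List.mem_filterMap.2 ⟨q.1.zip q'.1, (h _).2 hl,
      transOf_eq_some.2 ⟨⟨hl, ?_, hc⟩, h₁.symm, Prod.ext rfl ?_, h₂.symm⟩⟩⟩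
    · rw [h₁, h₂]
      exact (Formula.step_congr fun O hO => hm' _ ⟨O, hO, rfl⟩).2 hs
    · exact hm.trans ((φ.obsSet_eq_iff _ _).2 hm').symm

theorem map_pair_eq_zip_replicate {α β : Type} (l : List α) (b : β) :
    l.map (·, b) = l.zip (List.replicate l.length b) := by
  induction l with
  | nil => rfl
  | cons a l ih => simp [List.replicate_succ, ih]

theorem exists_map_some_of_none_notMem {α : Type} {l : List (Option α)} (h : none ∉ l) :
    ∃ l' : List α, l = l'.map some := by
  refine ⟨l.filterMap id, ?_⟩
  induction l with
  | nil => rfl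
  | cons a l ih =>
    simp only [List.mem_cons, not_or] at h
    cases a with
    | none => exact absurd rfl h.1
    | some a => simpa using ih h.2

theorem flatMap_filterMap_eq {α β γ : Type} {f : α → Option β} {g : α → List γ} {h : β → List γ}
    (l : List α) (hg : ∀ a ∈ l, g a = (f a).elim [] h) :
    l.flatMap g = (l.filterMap f).flatMap h := by
  induction l with
  | nil => rfl
  | cons a l ih =>
    have := hg a (by simp)
    have ih := ih fun b hb => hg b (List.mem_cons_of_mem _ hb)
    rw [List.flatMap_cons, this, ih]
    cases hf : f a <;> simp [hf]

/-- The record that a word of digits gives for a kind. -/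
noncomputable def Formula.target (φ : Formula V Ch D K CV) :
    Kind V Ch D K CV → List Digit → List (OutSym V)
  | none, es => (stateOf φ.size es).elim []
      (stateRecord φ.automaton fun q => stateName q.1)
  | some a, es => (φ.transOf a es).elim [] (transRecord φ.automaton fun q => stateName q.1)

theorem final_iff (l : List (Bool × Bool)) : Final l ↔ ∀ b ∈ l, b.2 = true := by
  rw [List.forall_mem_iff_getElem]
  unfold Final entry
  refine forall₂_congr fun p hp => ?_
  rw [List.getD_eq_getElem _ _ hp]

theorem entry_map_fst (es : List Digit) (k : ℕ) :
    entry (es.map Prod.fst) k = (es.getD k zeroDigit).1 :=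
  List.getD_map es zeroDigit Prod.fst

theorem entry_map_snd (es : List Digit) (k : ℕ) :
    entry (es.map Prod.snd) k = (es.getD k zeroDigit).2 :=
  List.getD_map es zeroDigit Prod.snd

theorem forall_mem_zip {α β : Type} {w : List α} {es : List β} (h : w.length = es.length)
    (p : β → Prop) : (∀ x ∈ w.zip es, p x.2) ↔ ∀ e ∈ es, p e := by
  conv_rhs => rw [← List.map_snd_zip (l₁ := w) (l₂ := es) h.ge]
  simp only [Prod.forall, List.mem_map, Prod.exists, exists_eq_right, forall_exists_index]
  exact forall_comm

variable [Finite V] [Finite Ch] [Finite D] [Finite K] [Finite CV]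
  {nextKind : Kind V Ch D K CV → Option (Kind V Ch D K CV)} {succ : Digit → Option Digit}

theorem Formula.exists_record_eq_target (φ : Formula V Ch D K CV) (κ : Kind V Ch D K CV)
    (es : List Digit) (hl : es.length = φ.word.length) :
    ∃ y r, y.map (fun x => (x.1, x.2.1)) = φ.word.zip es ∧
      (sweeper nextKind succ).Eval (φ.word.zip es) y [r, Val.bot] ∧
      κ.record y r = φ.target κ es := by
  classical
  obtain ⟨y, r, he, hc, hk, hb⟩ := φ.exists_evaluates (nextKind := nextKind) (succ := succ)
    (es.getD · zeroDigit) 0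
  have hz := cells_getD zeroDigit φ.word es hl.symm
  have hforget := he.forget
  have hfin := he.fin
  have hblank := he.blank
  rw [hz] at hforget hfin hblank
  rw [forall_mem_zip hl.symm (fun e : Digit => e.1.2 = true)] at hfin
  rw [forall_mem_zip hl.symm (fun e : Digit => e.2 = (false, false))] at hblank
  have hF : r.fin ↔ Final (es.map Prod.fst) := by rw [hfin, final_iff]; simp
  have hinit : r.now ↔ (entry (es.map Prod.fst) 0).1 = true := by
    rw [he.now, entry_map_fst]
  have hfst : y.flatMap (fun x => (bits x.2.1.1).map OutSym.bit) =
      (stateName (es.map Prod.fst)).map (OutSym.bit (V := V)) := by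
    have : es = y.map fun x => x.2.1 := by
      rw [← List.map_snd_zip (l₁ := φ.word) (l₂ := es) hl.le, ← hforget]
      simp
    rw [this]
    simp [stateName, List.flatMap_map, List.map_flatMap]
  have hsnd : y.flatMap (fun x => (bits x.2.1.2).map OutSym.bit) =
      (stateName (es.map Prod.snd)).map (OutSym.bit (V := V)) := by
    have : es = y.map fun x => x.2.1 := by
      rw [← List.map_snd_zip (l₁ := φ.word) (l₂ := es) hl.le, ← hforget]
      simp
    rw [this]
    simp [stateName, List.flatMap_map, List.map_flatMap]
  refine ⟨y, r, hforget, ?_, ?_⟩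
  · have := he.parses [] [] [Val.bot] (.nil (P := sweeper nextKind succ))
    rw [hz] at this
    exact this.of_eq (List.append_nil _) (List.append_nil _)
  · cases κ with
    | none =>
      rw [Kind.record, target, stateOf]
      by_cases h : ∀ e ∈ es, e.2 = (false, false)
      · rw [if_pos (show Kind.Check none r from hblank.2 h), dif_pos ⟨hl, h⟩]
        -- The record of a state is complete after part `0`; the other two rounds print nothing.
        have b₁ : ∀ j ≠ 0, y.flatMap (Kind.body none j) = [] := fun j hj => by
          simp [Kind.body, hj]
        have b₀ : y.flatMap (Kind.body none 0) =
          (stateName (es.map Prod.fst)).map (OutSym.bit (V := V)) := hfst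
        rw [b₁ 1 (by decide), b₁ 2 (by decide), b₀]
        have d₁ : decide r.now = decide ((firstState es hl : φ.automaton.Q) ∈ φ.automaton.init) :=
          decide_eq_decide.2 hinit
        have d₂ : decide r.fin = decide ((firstState es hl : φ.automaton.Q) ∈ φ.automaton.F) :=
          decide_eq_decide.2 hF
        simp only [Kind.header, List.append_nil, List.cons_append, List.nil_append, d₁, d₂]
        rfl
      · rw [if_neg (show ¬ Kind.Check none r from fun h' => h (hblank.1 h')),
          dif_neg fun h' => h h'.2]
        rfl
    | some a =>
      rw [Kind.record, target, transOf]
      have hcheck : Kind.Check (some a) r ↔ φ.Step a (Final (es.map Prod.fst))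
          (entry (es.map Prod.fst)) (entry (es.map Prod.snd)) 0 ∧ Canonical φ.classes a.2 := by
        rw [Kind.Check, hk, hc, propext hF, funext (entry_map_fst es), funext (entry_map_snd es)]
        rfl
      by_cases h : Kind.Check (some a) r
      · rw [if_pos h, dif_pos ⟨hl, hcheck.1 h⟩]
        have b₀ : y.flatMap (Kind.body (some a) 0) =
          (stateName (es.map Prod.fst)).map (OutSym.bit (V := V)) := hfst
        have b₂ : y.flatMap (Kind.body (some a) 2) =
          (stateName (es.map Prod.snd)).map (OutSym.bit (V := V)) := hsnd
        have b₁ : y.flatMap (Kind.body (some a) 1) =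
          φ.descriptors.map fun O => .bit (decide (O.Sat a.2)) := hb a.2
        rw [b₀, b₁, b₂]
        have hd : φ.descriptors.map (fun O => OutSym.bit (V := V) (decide (O.Sat a.2))) =
            φ.descriptors.attach.map
              fun O => .bit (decide (O ∈ φ.obsSet a.2)) := by
          conv_lhs => rw [← List.attach_map_subtype_val φ.descriptors, List.map_map]
          rfl
        rw [hd]
        simp only [Kind.header, List.cons_append, List.nil_append]
        rfl
      · rw [if_neg h, dif_neg fun h' => h (hcheck.2 h'.2)]
        rfl

end Description

end LTOL

/-! ### Assembly of the automaton and its machine -/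

theorem corollary2 :
    ∃ C : ℕ, ∀ (V Ch D K CV : Type) [Fintype V] [Fintype Ch] [Fintype D] [Fintype K] [Fintype CV],
      ∃ M : LTOL.Machine (LTOL.Token V Ch D K CV) (LTOL.OutSym V),
        ∀ φ : LTOL.Formula V Ch D K CV, ∃ N : LTOL.NBW φ.Letter,
          (⋃ w ∈ N.lang, φ.wordLang w) = {ρ | φ.SatAt ρ 0} ∧
          N.numStates ≤ 2 ^ (C * φ.size) ∧
          N.numTransitions ≤
            N.numStates ^ 2 * Nat.card (V → Bool) * Nat.card (Set φ.Obs) ∧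
          N.numTransitions ≤ 2 ^ Fintype.card V * 2 ^ (C * φ.size) ∧
          N.size ≤ 2 ^ Fintype.card V * 2 ^ (C * φ.size) ∧
          (∃ out, M.HaltsWith φ.word out ∧ LTOL.IsDescription N out) ∧
          M.UsesSpace φ.word (C * φ.size) := by
  classical
  -- With `n = |φ|`, there are `2 ^ (2n)` states and at most `2 ^ |V| * 2 ^ (4n + n)` transitions;
  -- the product gives the exponent `7n`. The space `2n + 3` is below this since `n ≥ 1`.
  refine ⟨7, fun V Ch D K CV _ _ _ _ _ => ?_⟩
  -- The enumeration of kinds starts with `none`, so all state records precede the transition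
  -- records.
  obtain ⟨nextKind, as, hκ, hnd, hmem⟩ :=
    LTOL.exists_enumerates (none : LTOL.Kind V Ch D K CV)
  obtain ⟨succ, ds, hd, hdn, hdm⟩ := LTOL.exists_enumerates LTOL.zeroDigit
  refine ⟨(LTOL.sweeper nextKind succ).machine, fun φ => ⟨φ.automaton, ?_⟩⟩
  have hφ : 0 < φ.size := by cases φ <;> simp [LTOL.Formula.size, LTOL.Formula.word]
  obtain ⟨ws, hws, hwn, hwm⟩ := hd.words hdn hdm φ.size
  have hrounds := LTOL.rounds_kinds
    (fun κ es hl => φ.exists_record_eq_target (nextKind := nextKind) (succ := succ) κ es hl) hws hκ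
  have hspec := LTOL.Sweeper.Rounds.machine_spec (P := LTOL.sweeper nextKind succ) (w := φ.word)
    (out := (none :: as).flatMap fun κ => ws.flatMap (φ.target κ)) (by
      have hz : φ.word.map (·, LTOL.zeroDigit) =
          φ.word.zip (List.replicate φ.word.length LTOL.zeroDigit) :=
        LTOL.map_pair_eq_zip_replicate _ _
      exact (congrArg (fun u => (LTOL.sweeper nextKind succ).Rounds (none, (0 : Fin 3)) u _)
        hz).mpr hrounds)
  have ht := φ.numTransitions_automaton_le
  have hs := φ.numStates_automaton
  have ht' : φ.automaton.numTransitions ≤ 2 ^ Fintype.card V * 2 ^ (5 * φ.size) := by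
    refine ht.trans ?_
    rw [hs, Nat.card_eq_fintype_card, Fintype.card_fun, Fintype.card_bool]
    calc (2 ^ (2 * φ.size)) ^ 2 * 2 ^ Fintype.card V * Nat.card (Set φ.Obs)
        ≤ (2 ^ (2 * φ.size)) ^ 2 * 2 ^ Fintype.card V * 2 ^ φ.size :=
          Nat.mul_le_mul_left _ φ.card_set_obs_le
      _ = 2 ^ Fintype.card V * 2 ^ (5 * φ.size) := by ring
  refine ⟨φ.iUnion_wordLang_automaton, ?_, ht, ?_, ?_, ⟨_, hspec.1, ?_⟩, ?_⟩
  · rw [hs]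
    exact Nat.pow_le_pow_right (by norm_num) (by omega)
  · exact ht'.trans (Nat.mul_le_mul_left _ (Nat.pow_le_pow_right (by norm_num) (by omega)))
  · calc φ.automaton.size ≤ 2 ^ (2 * φ.size) * (2 ^ Fintype.card V * 2 ^ (5 * φ.size)) := by
          rw [LTOL.NBW.size, hs]
          exact Nat.mul_le_mul_left _ ht'
      _ = 2 ^ Fintype.card V * 2 ^ (7 * φ.size) := by ring
  · obtain ⟨letters, rfl⟩ := LTOL.exists_map_some_of_none_notMem (List.nodup_cons.1 hnd).1
    refine ⟨fun q => LTOL.stateName q.1, ws.filterMap (LTOL.stateOf φ.size),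
      letters.flatMap fun a => ws.filterMap (φ.transOf a),
      LTOL.stateName_injective.comp Subtype.val_injective, LTOL.nodup_filterMap_stateOf hwn,
      LTOL.mem_filterMap_stateOf hwm, φ.nodup_transOf hwn ?_, φ.mem_transOf hwm ?_, ?_⟩
    · exact List.Nodup.of_map _ (List.nodup_cons.1 hnd).2
    · intro a
      simpa using hmem (some a)
    · rw [List.flatMap_cons]
      congr 1
      · exact LTOL.flatMap_filterMap_eq _ fun _ _ => rfl
      · rw [List.flatMap_map, List.flatMap_assoc]
        congr 1
        funext a
        exact LTOL.flatMap_filterMap_eq _ fun _ _ => rfl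
  · obtain ⟨b, hb, h⟩ := hspec.2
    exact ⟨b, hb.trans (by change _ ≤ 7 * φ.word.length; change 0 < φ.word.length at hφ; omega), h⟩
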